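/- **Conventions.** A *Boolean circuit* on $n$ input bits is a directed acyclic graph whose sources include the input bits. Each gate applies a Boolean function to the values of the (distinct) nodes it reads. Its *size* is the number of gates, and its *depth* is the length of a longest path ending at the output. A Boolean function $g\colon\{0,1\}^k\to\{0,1\}$ is *symmetric* if $g(x)$ depends only on the Hamming weight $|x|=x_1+\dots+x_k$. A *QAC circuit* is a product $M_D\cdots M_1$ of layers. Each layer is a product of gates on pairwise disjoint sets of qubits, and each gate is either an arbitrary single-qubit unitary or a generalized Toffoli gate $|x_1,\dots,x_k\rangle|b\rangle\mapsto|x_1,\dots,x_k\rangle|b\oplus(x_1\wedge\dots\wedge x_k)\rangle$. Its *depth* is the number $D$ of layers, and its *size* is the total number of gates and qubits. On an $N$-bit input $y$, a QAC circuit $A$ with $a$ ancillas *outputs $b$ with probability $\rho$* if measuring the last qubit of $A\,|y\rangle|0^a\rangle|0\rangle$ in the computational basis yields $b$ with probability $\rho$. Circuit families are non-uniform. **Theorem.** 1. For every $d\in\mathbb N$ there is $D\in\mathbb N$ such that for all polynomials $s,q$ with coefficients in $\mathbb N$ there is a polynomial $p$ with coefficients in $\mathbb N$ such that the following holds for every $n\in\mathbb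 N$. If $f\colon\{0,1\}^n\to\{0,1\}$ is exactly computed by a Boolean circuit of depth at most $d$ and size at most $s(n)$ all of whose gates are symmetric functions (of arbitrary fan-in), then there are $m\le p(n)$ and a QAC circuit of depth at most $D$ and size at most $p(n)$ (ancillas included) that takes $nm$ input bits and, for every $x\in\{0,1\}^n$, on the input $|\underbrace{x,x,\dots,x}_{m\text{ copies}}\rangle$ outputs $f(x)$ with probability at least $1-2^{-q(n)}$. 2. $\mathsf{TC}^0\subseteq\mathsf{BQAC}^0\circ\mathsf{NC}^0$. Here languages are identified with families $(f_n)_{n\in\mathbb N}$ of functions $f_n\colon\{0,1\}^n\to\{0,1\}$. - $\mathsf{TC}^0$ is the class of languages exactly computed by constant-depth polynomial-size Boolean circuits with gates $\neg$ and $\mathrm{Th}_{\ge k}$ ($k\ge0$), where $\mathrm{Th}_{\ge k}(x)=1$ iff $|x|\ge k$. - $\mathsf{BQAC}^0$ is the class of languages $(h_N)_N$ for which there are constant-depth polynomial-size QAC circuits that, on every input $y\in\{0,1\}^N$, output $h_N(y)$ with probability at least $2/3$. - $\mathsf{BQAC}^0\circ\mathsf{NC}^0$ is the class of languages $(f_n)_n$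 of the form $f_n=h_{\ell(n)}\circ g_n$, where $(h_N)_N\in\mathsf{BQAC}^0$, the function $\ell\colon\mathbb N\to\mathbb N$ is polynomially bounded, and $g_n\colon\{0,1\}^n\to\{0,1\}^{\ell(n)}$ is such that every output bit of every $g_n$ is computed by a Boolean circuit with gates $\neg,\mathsf{AND},\mathsf{OR}$ whose depth and fan-in are bounded by constants independent of $n$ and of the bit. -/

import Mathlib

open Finset Polynomial

/-! ### Boolean functions and classical circuits -/

/-- The Hamming weight of a bit string indexed by `ι`. -/
def hammingWeight {ι : Type} [Fintype ι] (x : ι → Bool) : ℕ :=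
  (univ.filter fun i => x i = true).card

/-- A Boolean function is symmetric if its value depends only on the Hamming weight. -/
def SymmetricGate (ι : Type) [Fintype ι] (f : (ι → Bool) → Bool) : Prop :=
  ∀ x y : ι → Bool, hammingWeight x = hammingWeight y → f x = f y

/-- The negation of one bit. -/
def NotGate (ι : Type) [Fintype ι] (f : (ι → Bool) → Bool) : Prop :=
  ∃ i : ι, (∀ j : ι, j = i) ∧ ∀ x, f x = !(x i)

/-- The gate set `{¬} ∪ {Th_{≥ k} : k ≥ 0}`. -/
def ThresholdGate (ι : Type) [Fintype ι] (f : (ι → Bool) → Bool) : Prop :=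
  NotGate ι f ∨ ∃ k : ℕ, ∀ x, f x = decide (k ≤ hammingWeight x)

/-- The gate set `{¬, AND, OR}`. -/
def AndOrNotGate (ι : Type) [Fintype ι] (f : (ι → Bool) → Bool) : Prop :=
  NotGate ι f ∨ (∀ x, f x = true ↔ ∀ i, x i = true) ∨ (∀ x, f x = true ↔ ∃ i, x i = true)

/-- A Boolean circuit on `n` input bits: a directed acyclic graph whose nodes are the inputs
(`Sum.inl`) and the gates (`Sum.inr`), the latter numbered in a topological order. The gate `i`
reads the set `ins i` of nodes and applies the Boolean function `fn i` to their values. Fan-out is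
unrestricted. The size is the number of gates. -/
structure BoolCircuit (n : ℕ) where
  size : ℕ
  ins : Fin size → Finset (Fin n ⊕ Fin size)
  acyclic : ∀ i j : Fin size, Sum.inr j ∈ ins i → j < i
  fn : ∀ i : Fin size, (ins i → Bool) → Bool
  out : Fin n ⊕ Fin size

namespace BoolCircuit

variable {n : ℕ}

/-- The value of a gate on the input `x`. -/
def gateVal (C : BoolCircuit n) (x : Fin n → Bool) (i : Fin C.size) : Bool :=
  C.fn i fun w =>
    match h : w.1 with
    | Sum.inl k => x k
    | Sum.inr j =>
      have : j < i := C.acyclic i j (h ▸ w.2)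
      C.gateVal x j
termination_by i

/-- The value of a node on the input `x`. -/
def nodeVal (C : BoolCircuit n) (x : Fin n → Bool) : Fin n ⊕ Fin C.size → Bool
  | Sum.inl k => x k
  | Sum.inr j => C.gateVal x j

theorem gateVal_eq (C : BoolCircuit n) (x : Fin n → Bool) (i : Fin C.size) :
    C.gateVal x i = C.fn i fun w => C.nodeVal x w := by
  rw [gateVal]
  congr 1
  funext w
  obtain ⟨w | w, hw⟩ := w <;> rfl

/-- The output of the circuit on the input `x`. -/
def eval (C : BoolCircuit n) (x : Fin n → Bool) : Bool := C.nodeVal x C.out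

/-- The length (number of edges) of a longest path ending at a gate. -/
def gateDepth (C : BoolCircuit n) (i : Fin C.size) : ℕ :=
  (C.ins i).attach.sup fun w =>
    match h : w.1 with
    | Sum.inl _ => 1
    | Sum.inr j =>
      have : j < i := C.acyclic i j (h ▸ w.2)
      C.gateDepth j + 1
termination_by i

/-- The length of a longest path ending at a node. -/
def nodeDepth (C : BoolCircuit n) : Fin n ⊕ Fin C.size → ℕ
  | Sum.inl _ => 0
  | Sum.inr j => C.gateDepth j

theorem gateDepth_eq (C : BoolCircuit n) (i : Fin C.size) :
    C.gateDepth i = (C.ins i).sup fun w => C.nodeDepth w + 1 := by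
  rw [gateDepth, ← Finset.sup_attach (C.ins i) fun w => C.nodeDepth w + 1]
  refine Finset.sup_congr rfl fun w _ => ?_
  obtain ⟨w | w, hw⟩ := w <;> rfl

/-- The depth of the circuit: the length of a longest path ending at the output node. -/
def depth (C : BoolCircuit n) : ℕ := C.nodeDepth C.out

/-- All gates of the circuit belong to the gate set `G`. -/
def UsesGates (C : BoolCircuit n)
    (G : ∀ (ι : Type) [Fintype ι], ((ι → Bool) → Bool) → Prop) : Prop :=
  ∀ i : Fin C.size, G (C.ins i) (C.fn i)

/-- Every gate of the circuit has at most `c` input wires. -/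
def FaninLE (C : BoolCircuit n) (c : ℕ) : Prop := ∀ i : Fin C.size, (C.ins i).card ≤ c

/-- The circuit computes `f` exactly. -/
def Computes (C : BoolCircuit n) (f : (Fin n → Bool) → Bool) : Prop := ∀ x, C.eval x = f x

end BoolCircuit

/-! ### QAC circuits -/

/-- A gate of a QAC circuit on the qubits `Q`: an arbitrary single-qubit unitary `U` on the qubit
`q`, or the generalized Toffoli gate which flips the target `t` when all controls in `S` are `1`
(for empty `S` this is the single-qubit NOT gate). -/
inductive QACGate (Q : Type) where
  | single (q : Q) (U : Matrix.unitaryGroup Bool ℂ) : QACGate Q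
  | toffoli (S : Finset Q) (t : Q) (ht : t ∉ S) : QACGate Q

namespace QACGate

variable {Q : Type} [Fintype Q] [DecidableEq Q]

/-- The set of qubits on which a gate operates. -/
def support : QACGate Q → Finset Q
  | single q _ => {q}
  | toffoli S t _ => insert t S

/-- The matrix of a gate in the computational basis, as an operator on all the qubits. The entry at
`(y, x)` is the amplitude of `|y⟩` in the image of `|x⟩`. -/
def toMatrix : QACGate Q → Matrix (Q → Bool) (Q → Bool) ℂ
  | single q U => Matrix.of fun y x =>
      if ∀ r, r ≠ q → y r = x r then (U : Matrix Bool Bool ℂ) (y q) (x q) else 0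
  | toffoli S t _ => Matrix.of fun y x =>
      if y = Function.update x t (xor (x t) (decide (∀ s ∈ S, x s = true))) then 1 else 0

end QACGate

/-- A layer: gates operating on pairwise disjoint sets of qubits. -/
structure QACLayer (Q : Type) [Fintype Q] [DecidableEq Q] where
  gates : List (QACGate Q)
  disjoint : gates.Pairwise fun g h => Disjoint g.support h.support

/-- A QAC circuit: a list of layers `M₁, …, M_d`, where `M₁` is applied first. -/
structure QACCircuit (Q : Type) [Fintype Q] [DecidableEq Q] where
  layers : List (QACLayer Q)

namespace QACCircuit

variable {Q : Type} [Fintype Q] [DecidableEq Q]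

/-- The number of layers. -/
def depth (C : QACCircuit Q) : ℕ := C.layers.length

/-- The total number of gates and qubits. -/
def size (C : QACCircuit Q) : ℕ :=
  (C.layers.map fun M => M.gates.length).sum + Fintype.card Q

/-- The operator `M_d ⋯ M₁` computed by the circuit. -/
noncomputable def toMatrix (C : QACCircuit Q) : Matrix (Q → Bool) (Q → Bool) ℂ :=
  (C.layers.reverse.map fun M => (M.gates.map QACGate.toMatrix).prod).prod

end QACCircuit

/-- The qubits of a circuit with input bits indexed by `I`, with `a` ancillas and with one output
qubit. -/
abbrev Register (I : Type) (a : ℕ) : Type := I ⊕ (Fin a ⊕ Unit)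

/-- The label of the initial basis state `|x⟩|0^a⟩|0⟩`. -/
def Register.init {I : Type} {a : ℕ} (x : I → Bool) : Register I a → Bool :=
  Sum.elim x fun _ => false

/-- The probability that the output qubit of `C|x⟩|0^a⟩|0⟩`, measured in the computational basis,
yields `b`. -/
noncomputable def QACCircuit.outputProb {I : Type} [Fintype I] [DecidableEq I] {a : ℕ}
    (C : QACCircuit (Register I a)) (x : I → Bool) (b : Bool) : ℝ :=
  ∑ y : Register I a → Bool with y (Sum.inr (Sum.inr ())) = b,
    ‖C.toMatrix y (Register.init x)‖ ^ 2

/-! ### Complexity classes -/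

/-- A language over `{0,1}`, given by its indicator function on each input length. -/
abbrev BoolFamily : Type := ∀ n : ℕ, (Fin n → Bool) → Bool

/-- Languages exactly decided by constant-depth polynomial-size circuits over `{¬, Th_{≥ k}}`. -/
def TC0 : Set BoolFamily :=
  {f | ∃ (d : ℕ) (p : ℕ[X]), ∀ n, ∃ C : BoolCircuit n,
    C.UsesGates ThresholdGate ∧ C.depth ≤ d ∧ C.size ≤ p.eval n ∧ C.Computes (f n)}

/-- Languages decided with error at most `1/3` by constant-depth polynomial-size QAC circuits. -/
def BQAC0 : Set BoolFamily :=
  {f | ∃ (d : ℕ) (p : ℕ[X]), ∀ n, ∃ (a : ℕ) (C : QACCircuit (Register (Fin n) a)),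
    C.depth ≤ d ∧ C.size ≤ p.eval n ∧ ∀ x, 1 - 1 / 3 ≤ C.outputProb x (f n x)}

/-- Families of multi-bit functions of polynomial output length, all of whose output bits are
computed by circuits over `{¬, AND, OR}` of constant depth and constant fan-in. -/
def NC0Computable (l : ℕ → ℕ) (g : ∀ n : ℕ, (Fin n → Bool) → (Fin (l n) → Bool)) : Prop :=
  (∃ p : ℕ[X], ∀ n, l n ≤ p.eval n) ∧
  ∃ d c : ℕ, ∀ (n : ℕ) (j : Fin (l n)), ∃ C : BoolCircuit n,
    C.UsesGates AndOrNotGate ∧ C.FaninLE c ∧ C.depth ≤ d ∧ C.Computes fun x => g n x j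

/-- The class `K ∘ NC⁰` of the languages obtained by composing a language of `K` with an
`NC⁰`-computable function. -/
def compNC0 (K : Set BoolFamily) : Set BoolFamily :=
  {f | ∃ (l : ℕ → ℕ) (g : ∀ n : ℕ, (Fin n → Bool) → (Fin (l n) → Bool)),
    NC0Computable l g ∧ ∃ h ∈ K, ∀ n x, f n x = h (l n) (g n x)}

/-! ### Matrices on bit strings: classical maps, Kronecker products, extension by the identity. -/

section Matrices

/-! The heart is a test for weight exactly `k`. Each input bit gets a coin qubit, prepared by a
rotation `U` with probabilities `r` and `1 - r`. A flag qubit is flipped if no coin shows 1 at a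
position where `x` does; then the auxiliary products are uncomputed, the coins are rotated back by
`star U`, and the flag is rotated by `W`. The event has coin probability `r ^ |x|`, so the amplitude
of returning to all zeros is `u₀ (1 - r ^ |x|) + u₁ r ^ |x|`. Taking `(u₀, u₁)` proportional to `(r
^ k, -(1 - r ^ k))` turns this into a multiple of `r ^ k - r ^ |x|`, which vanishes exactly at
weight `k` (for `0 < r < 1`). The OR of the work qubits is therefore surely 1 at weight `k`, and is
0 with probability of order at least `1 / N ^ 2` at any other weight up to `N`
(`exists_isGadget_weightTest`, `weightTest_gap`). An AND of polynomially many runs makes the error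
exponentially small (`approximates_exactWeight`), and an OR over the accepted weights gives any
symmetric gate (`exists_approximates_symmetricGate`).

These gadgets are composed without cleaning up. A gadget uses its inputs only as controls, so a
later gadget reading its output behaves as if that qubit had been measured (`outcomeProb_seq`), and
gadgets on disjoint qubits have independent outcomes (`sum_parallelMatrix`). Errors then add up by a
union bound (`Approximates.comp`). Since fan-out is not available, a Boolean circuit is unfolded
into a tree whose leaves read separate copies of the input bits; constant depth keeps the number of
copies polynomial (`exists_copyApproximates_nodeVal`).

For the inclusion of classes, copying the input is the `NC⁰` map, and the `BQAC⁰` language consists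
of the copies of accepted strings. Its circuit must be correct on all inputs, so a final check that
the alleged copies agree is added (`IsGadget.guard`): they agree iff the input is invariant under a
cyclic shift of the copies. -/

/-- The matrix of a classical map of bit strings. -/
def permMatrix {X : Type} [DecidableEq X] (F : X → X) : Matrix X X ℂ :=
  Matrix.of fun y x => if y = F x then 1 else 0

theorem permMatrix_mul {X : Type} [DecidableEq X] [Fintype X] (F G : X → X) :
    permMatrix F * permMatrix G = permMatrix (F ∘ G) := by
  ext y x
  simp [permMatrix, Matrix.mul_apply]

theorem permMatrix_id {X : Type} [DecidableEq X] : permMatrix (id : X → X) = 1 := by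
  ext y x
  simp [permMatrix, Matrix.one_apply]

theorem mul_permMatrix_apply {X : Type} [DecidableEq X] [Fintype X] (A : Matrix X X ℂ)
    (F : X → X) (y x : X) : (A * permMatrix F) y x = A y (F x) := by
  simp [permMatrix, Matrix.mul_apply]

variable {J : Type} [Fintype J] [DecidableEq J]

/-- The Kronecker product of a family of matrices. -/
def piKron {X : J → Type} [∀ j, Fintype (X j)] [∀ j, DecidableEq (X j)] :
    (∀ j, Matrix (X j) (X j) ℂ) →* Matrix (∀ j, X j) (∀ j, X j) ℂ where
  toFun A := Matrix.of fun y x => ∏ j, A j (y j) (x j)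
  map_one' := by
    ext y x
    by_cases h : y = x
    · subst h; simp
    · obtain ⟨j, hj⟩ := Function.ne_iff.1 h
      rw [Matrix.one_apply_ne h]
      exact Finset.prod_eq_zero (mem_univ j) (Matrix.one_apply_ne hj)
  map_mul' A B := by
    ext y x
    simp only [Matrix.of_apply, Pi.mul_apply, Matrix.mul_apply, Finset.prod_univ_sum,
      Finset.prod_mul_distrib, Fintype.piFinset_univ]

theorem piKron_apply {X : J → Type} [∀ j, Fintype (X j)] [∀ j, DecidableEq (X j)]
    (A : ∀ j, Matrix (X j) (X j) ℂ) (y x : ∀ j, X j) :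
    piKron A y x = ∏ j, A j (y j) (x j) := rfl

theorem piKron_conjTranspose {X : J → Type} [∀ j, Fintype (X j)] [∀ j, DecidableEq (X j)]
    (A : ∀ j, Matrix (X j) (X j) ℂ) :
    (piKron A).conjTranspose = piKron fun j => (A j).conjTranspose := by
  ext y x
  simp [piKron_apply, Matrix.conjTranspose_apply]

theorem piKron_mulSingle_apply {X : J → Type} [∀ j, Fintype (X j)] [∀ j, DecidableEq (X j)]
    (j : J) (A : Matrix (X j) (X j) ℂ) (y x : ∀ j, X j) :
    piKron (Pi.mulSingle j A) y x = if ∀ k, k ≠ j → y k = x k then A (y j) (x j) else 0 := by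
  rw [piKron_apply, Fintype.prod_eq_mul_prod_compl j]
  have hc : ∀ k ∈ ({j}ᶜ : Finset J), (Pi.mulSingle j A : ∀ j, Matrix (X j) (X j) ℂ) k (y k) (x k)
      = if y k = x k then 1 else 0 := by
    intro k hk
    rw [Pi.mulSingle_eq_of_ne (by simpa using hk), Matrix.one_apply]
  rw [Finset.prod_congr rfl hc]
  split_ifs with h
  · rw [Finset.prod_eq_one fun k hk => if_pos (h k (by simpa using hk))]
    simp
  · push Not at h
    obtain ⟨k, hk, hne⟩ := h
    rw [Finset.prod_eq_zero (i := k) (by simpa using hk) (if_neg hne), mul_zero]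

-- Factors at distinct coordinates do not interact, so a tensor product may be realized by applying
-- its local factors one after another. This is what identifies the ordered product over a gate list
-- with a Kronecker product.
omit [Fintype J] in
theorem list_prod_map_mulSingle {M : J → Type} [∀ j, Monoid (M j)] (A : ∀ j, M j) (l : List J)
    (hl : l.Nodup) (k : J) :
    (l.map fun j => (Pi.mulSingle j (A j) : ∀ j, M j)).prod k = if k ∈ l then A k else 1 := by
  induction l with
  | nil => simp
  | cons j l ih =>
    rw [List.nodup_cons] at hl
    simp only [List.map_cons, List.prod_cons, Pi.mul_apply, ih hl.2, List.mem_cons]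
    by_cases h : k = j
    · subst h; simp [hl.1]
    · simp [h]

theorem list_prod_univ_mulSingle {M : J → Type} [∀ j, Monoid (M j)] (A : ∀ j, M j) :
    ((univ : Finset J).toList.map fun j => (Pi.mulSingle j (A j) : ∀ j, M j)).prod = A := by
  funext k
  rw [list_prod_map_mulSingle A _ (Finset.nodup_toList _)]
  simp

/-- The extension of a matrix by the identity along an embedding of qubits. -/
def liftMatrix {Q Q' : Type} [Fintype Q] [Fintype Q'] [DecidableEq Q] [DecidableEq Q']
    (e : Q ↪ Q') : Matrix (Q → Bool) (Q → Bool) ℂ →* Matrix (Q' → Bool) (Q' → Bool) ℂ where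
  toFun A := open Classical in
    Matrix.of fun y x => if ∀ r, r ∉ Set.range e → y r = x r then A (y ∘ e) (x ∘ e) else 0
  map_one' := by
    classical
    ext y x
    simp only [Matrix.of_apply, Matrix.one_apply, ← ite_and]
    refine if_congr ⟨fun ⟨h1, h2⟩ => funext fun r => ?_, fun h => ?_⟩ rfl rfl
    · by_cases hr : r ∈ Set.range e
      · obtain ⟨q, rfl⟩ := hr
        exact congrFun h2 q
      · exact h1 r hr
    · subst h; simp
  map_mul' A B := by
    classical
    ext y x
    simp only [Matrix.of_apply, Matrix.mul_apply]
    have key : ∀ u : Q → Bool, (Function.extend e u x) ∘ e = u :=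
      fun u => Function.extend_comp e.injective u x
    have key' : ∀ (u : Q → Bool) (r), r ∉ Set.range e → Function.extend e u x r = x r :=
      fun u r hr => Function.extend_apply' u x r hr
    split_ifs with h
    -- Only intermediate states agreeing with `x` off the range of `e` contribute, and these are the
    -- extensions of strings `u` on the smaller set of qubits.
    · refine Fintype.sum_of_injective (fun u => Function.extend e u x) ?_ _ _ ?_ ?_
      · intro u v huv
        simpa [key] using congrArg (fun z => z ∘ e) huv
      · intro z hz
        rw [mul_eq_zero]
        right
        rw [if_neg]
        intro hzx
        refine hz ⟨z ∘ e, funext fun r => ?_⟩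
        by_cases hr : r ∈ Set.range e
        · obtain ⟨q, rfl⟩ := hr
          exact congrFun (key (z ∘ e)) q
        · rw [hzx r hr]
          exact key' _ r hr
      · intro u
        rw [if_pos, if_pos (key' u), key u]
        intro r hr
        rw [key' u r hr, h r hr]
    · symm
      refine Finset.sum_eq_zero fun z _ => ?_
      rw [mul_eq_zero]
      by_contra! hne
      obtain ⟨h1, h2⟩ := hne
      rw [ite_ne_right_iff] at h1 h2
      exact h fun r hr => (h1.1 r hr).trans (h2.1 r hr)

open Classical in
theorem liftMatrix_apply {Q Q' : Type} [Fintype Q] [Fintype Q'] [DecidableEq Q] [DecidableEq Q']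
    (e : Q ↪ Q') (A : Matrix (Q → Bool) (Q → Bool) ℂ) (y x : Q' → Bool) :
    liftMatrix e A y x =
      if ∀ r, r ∉ Set.range e → y r = x r then A (y ∘ e) (x ∘ e) else 0 := rfl

end Matrices

/-! ### Gates: unitarity and relabelling of qubits. -/

section Gates

variable {Q Q' : Type} [Fintype Q] [Fintype Q'] [DecidableEq Q] [DecidableEq Q']

theorem QACGate.toMatrix_single (q : Q) (U : Matrix.unitaryGroup Bool ℂ) :
    (QACGate.single q U).toMatrix =
      piKron (X := fun _ : Q => Bool) (Pi.mulSingle q (U : Matrix Bool Bool ℂ)) := by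
  ext y x
  rw [piKron_mulSingle_apply]
  simp [QACGate.toMatrix]

/-- The action of a generalized Toffoli gate on bit strings. -/
def toffoliMap (S : Finset Q) (t : Q) (x : Q → Bool) : Q → Bool :=
  Function.update x t (xor (x t) (decide (∀ s ∈ S, x s = true)))

theorem QACGate.toMatrix_toffoli (S : Finset Q) (t : Q) (ht : t ∉ S) :
    (QACGate.toffoli S t ht).toMatrix = permMatrix (toffoliMap S t) := by
  ext y x
  simp only [QACGate.toMatrix, permMatrix, toffoliMap, Matrix.of_apply]
  exact if_congr Iff.rfl rfl rfl

theorem toffoliMap_involutive (S : Finset Q) (t : Q) (ht : t ∉ S) :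
    Function.Involutive (toffoliMap S t) := by
  intro x
  have h : (∀ s ∈ S, toffoliMap S t x s = true) ↔ ∀ s ∈ S, x s = true := by
    refine forall₂_congr fun s hs => ?_
    rw [toffoliMap, Function.update_of_ne (by rintro rfl; exact ht hs)]
  rw [toffoliMap]
  simp only [h]
  simp [toffoliMap]

theorem QACGate.conjTranspose_mul_self (g : QACGate Q) :
    g.toMatrix.conjTranspose * g.toMatrix = 1 := by
  cases g with
  | single q U =>
    rw [QACGate.toMatrix_single, piKron_conjTranspose, ← map_mul, ← map_one piKron]
    congr 1
    funext k
    by_cases hk : k = q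
    · subst hk
      simpa [Matrix.star_eq_conjTranspose] using (Matrix.mem_unitaryGroup_iff'.1 U.2)
    · simp [hk]
  | toffoli S t ht =>
    have : (permMatrix (toffoliMap S t)).conjTranspose = permMatrix (toffoliMap S t) := by
      ext y x
      have : x = toffoliMap S t y ↔ y = toffoliMap S t x :=
        ⟨fun h => by rw [h, toffoliMap_involutive S t ht],
          fun h => by rw [h, toffoliMap_involutive S t ht]⟩
      simp only [permMatrix, Matrix.conjTranspose_apply, Matrix.of_apply, this]
      split_ifs <;> simp
    rw [QACGate.toMatrix_toffoli, this, permMatrix_mul,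
      (toffoliMap_involutive S t ht).comp_self, permMatrix_id]

/-- The gate relabelled along an embedding of qubits. -/
def QACGate.map (e : Q ↪ Q') : QACGate Q → QACGate Q'
  | single q U => single (e q) U
  | toffoli S t ht => toffoli (S.map e) (e t) (by simpa using ht)

omit [Fintype Q] [Fintype Q'] in
theorem QACGate.support_map (e : Q ↪ Q') (g : QACGate Q) :
    (g.map e).support = g.support.map e := by
  cases g <;> simp [QACGate.map, QACGate.support, Finset.map_insert]

theorem QACGate.toMatrix_map (e : Q ↪ Q') (g : QACGate Q) :
    (g.map e).toMatrix = liftMatrix e g.toMatrix := by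
  classical
  ext y x
  rw [liftMatrix_apply]
  cases g with
  | single q U =>
    simp only [QACGate.map, QACGate.toMatrix, Matrix.of_apply, ← ite_and, Function.comp_apply]
    refine if_congr ⟨fun h => ⟨fun r hr => h r ?_, fun r hr => h _ ?_⟩, fun h r hr => ?_⟩ rfl rfl
    · rintro rfl; exact hr ⟨q, rfl⟩
    · simpa using hr
    · by_cases hr' : r ∈ Set.range e
      · obtain ⟨r, rfl⟩ := hr'
        exact h.2 r (by rintro rfl; exact hr rfl)
      · exact h.1 r hr'
  | toffoli S t ht =>
    simp only [QACGate.map, QACGate.toMatrix, Matrix.of_apply, ← ite_and]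
    refine if_congr ?_ rfl rfl
    have hS : (∀ s ∈ S.map e, x s = true) ↔ ∀ s ∈ S, (x ∘ e) s = true := by simp
    simp only [hS]
    constructor
    · rintro rfl
      refine ⟨fun r hr => ?_, ?_⟩
      · rw [Function.update_of_ne]
        rintro rfl; exact hr ⟨t, rfl⟩
      · rw [Function.update_comp_eq_of_injective _ e.injective]
        rfl
    · rintro ⟨h1, h2⟩
      funext r
      by_cases hr : r ∈ Set.range e
      · obtain ⟨r, rfl⟩ := hr
        have := congrFun h2 r
        rw [Function.comp_apply] at this
        rw [this]
        by_cases hrt : r = t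
        · subst hrt; simp
        · rw [Function.update_of_ne hrt, Function.update_of_ne (by simpa using hrt)]
          rfl
      · rw [h1 r hr, Function.update_of_ne]
        rintro rfl; exact hr ⟨t, rfl⟩

/-- The layer relabelled along an embedding of qubits. -/
def QACLayer.map (e : Q ↪ Q') (M : QACLayer Q) : QACLayer Q' where
  gates := M.gates.map (QACGate.map e)
  disjoint := by
    rw [List.pairwise_map]
    refine M.disjoint.imp fun h => ?_
    rw [QACGate.support_map, QACGate.support_map]
    exact (Finset.disjoint_map e).2 h

/-- The operator of a layer. -/
noncomputable def QACLayer.toMatrix (M : QACLayer Q) : Matrix (Q → Bool) (Q → Bool) ℂ :=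
  (M.gates.map QACGate.toMatrix).prod

theorem QACLayer.toMatrix_map (e : Q ↪ Q') (M : QACLayer Q) :
    (M.map e).toMatrix = liftMatrix e M.toMatrix := by
  rw [QACLayer.toMatrix, QACLayer.toMatrix, map_list_prod]
  simp only [QACLayer.map, List.map_map]
  congr 2
  funext g
  exact QACGate.toMatrix_map e g

end Gates

/-! ### Operators of QAC circuits and basic layers. -/

section HasCircuit

variable {Q Q' : Type} [Fintype Q] [Fintype Q'] [DecidableEq Q] [DecidableEq Q']

/-- `A` is the operator of a QAC circuit of depth `D` with at most `G` gates. -/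
def HasCircuit (D G : ℕ) (A : Matrix (Q → Bool) (Q → Bool) ℂ) : Prop :=
  ∃ C : QACCircuit Q, C.depth = D ∧ (C.layers.map fun M => M.gates.length).sum ≤ G ∧
    C.toMatrix = A

theorem HasCircuit.mul {D₁ D₂ G₁ G₂ : ℕ} {A₁ A₂ : Matrix (Q → Bool) (Q → Bool) ℂ}
    (h₂ : HasCircuit D₂ G₂ A₂) (h₁ : HasCircuit D₁ G₁ A₁) :
    HasCircuit (D₁ + D₂) (G₁ + G₂) (A₂ * A₁) := by
  obtain ⟨C₁, rfl, hG₁, rfl⟩ := h₁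
  obtain ⟨C₂, rfl, hG₂, rfl⟩ := h₂
  refine ⟨⟨C₁.layers ++ C₂.layers⟩, by simp [QACCircuit.depth], ?_, ?_⟩
  · simp only [List.map_append, List.sum_append]
    omega
  · simp [QACCircuit.toMatrix]

theorem HasCircuit.mono {D G G' : ℕ} {A : Matrix (Q → Bool) (Q → Bool) ℂ}
    (h : HasCircuit D G A) (hG : G ≤ G') : HasCircuit D G' A := by
  obtain ⟨C, h1, h2, h3⟩ := h
  exact ⟨C, h1, h2.trans hG, h3⟩

theorem HasCircuit.of_layer (M : QACLayer Q) : HasCircuit 1 M.gates.length M.toMatrix :=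
  ⟨⟨[M]⟩, rfl, by simp, by simp [QACCircuit.toMatrix, QACLayer.toMatrix]⟩

/-- Empty layers serve as padding: `HasCircuit` fixes the depth exactly, so that circuits run in
parallel can be matched layer by layer. -/
theorem HasCircuit.one (D : ℕ) : HasCircuit D 0 (1 : Matrix (Q → Bool) (Q → Bool) ℂ) :=
  ⟨⟨List.replicate D ⟨[], List.Pairwise.nil⟩⟩, by simp [QACCircuit.depth], by simp,
    by simp [QACCircuit.toMatrix]⟩

theorem HasCircuit.eq_one {G : ℕ} {A : Matrix (Q → Bool) (Q → Bool) ℂ}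
    (h : HasCircuit 0 G A) : A = 1 := by
  obtain ⟨⟨l⟩, h1, -, rfl⟩ := h
  obtain rfl := List.eq_nil_of_length_eq_zero h1
  rfl

theorem HasCircuit.exists_layer {D G : ℕ} {A : Matrix (Q → Bool) (Q → Bool) ℂ}
    (h : HasCircuit (D + 1) G A) : ∃ (M : QACLayer Q) (G' : ℕ)
      (A' : Matrix (Q → Bool) (Q → Bool) ℂ), HasCircuit D G' A' ∧ M.gates.length + G' ≤ G ∧
      A' * M.toMatrix = A := by
  obtain ⟨⟨l⟩, h1, h2, rfl⟩ := h
  obtain ⟨M, l, rfl⟩ := List.exists_cons_of_length_eq_add_one h1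
  refine ⟨M, _, _, ⟨⟨l⟩, by simpa [QACCircuit.depth] using h1, le_rfl, rfl⟩, by simpa using h2, ?_⟩
  simp [QACCircuit.toMatrix, QACLayer.toMatrix]

theorem HasCircuit.lift (e : Q ↪ Q') {D G : ℕ} {A : Matrix (Q → Bool) (Q → Bool) ℂ}
    (h : HasCircuit D G A) : HasCircuit D G (liftMatrix e A) := by
  induction D generalizing A G with
  | zero => rw [h.eq_one, map_one]; exact (HasCircuit.one 0).mono (Nat.zero_le _)
  | succ D ih =>
    obtain ⟨M, G', A', h1, h2, rfl⟩ := h.exists_layer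
    rw [map_mul, ← QACLayer.toMatrix_map]
    have := (ih h1).mul (HasCircuit.of_layer (M.map e))
    rw [Nat.add_comm] at this
    exact this.mono (by simpa [QACLayer.map] using h2)

theorem HasCircuit.conjTranspose_mul_self {D G : ℕ} {A : Matrix (Q → Bool) (Q → Bool) ℂ}
    (h : HasCircuit D G A) : A.conjTranspose * A = 1 := by
  have hl : ∀ l : List (Matrix (Q → Bool) (Q → Bool) ℂ),
      (∀ B ∈ l, B.conjTranspose * B = 1) → l.prod.conjTranspose * l.prod = 1 := by
    intro l hl
    induction l with
    | nil => simp
    | cons B l ih =>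
      rw [List.prod_cons, Matrix.conjTranspose_mul, Matrix.mul_assoc,
        ← Matrix.mul_assoc B.conjTranspose, hl B (by simp), Matrix.one_mul]
      exact ih fun B hB => hl B (by simp [hB])
  obtain ⟨C, -, -, rfl⟩ := h
  refine hl _ fun B hB => ?_
  obtain ⟨M, -, rfl⟩ := List.mem_map.1 hB
  refine hl _ fun B hB => ?_
  obtain ⟨g, -, rfl⟩ := List.mem_map.1 hB
  exact g.conjTranspose_mul_self

/-- The diagonal entries of `Aᴴ A = 1`: the outcome probabilities sum to 1. -/
theorem HasCircuit.sum_norm_sq {D G : ℕ} {A : Matrix (Q → Bool) (Q → Bool) ℂ}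
    (h : HasCircuit D G A) (x : Q → Bool) : ∑ y, ‖A y x‖ ^ 2 = 1 := by
  have := congrFun (congrFun h.conjTranspose_mul_self x) x
  simp only [Matrix.mul_apply, Matrix.conjTranspose_apply, Matrix.one_apply_eq,
    RCLike.star_def, Complex.conj_mul'] at this
  exact_mod_cast this

theorem HasCircuit.singleQubits (U : Q → Matrix.unitaryGroup Bool ℂ) :
    HasCircuit 1 (Fintype.card Q)
      (piKron (X := fun _ : Q => Bool) fun q => (U q : Matrix Bool Bool ℂ)) := by
  let M : QACLayer Q :=
    { gates := (univ : Finset Q).toList.map fun q => QACGate.single q (U q)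
      disjoint := by
        rw [List.pairwise_map]
        refine (Finset.nodup_toList univ).imp fun h => ?_
        simpa [QACGate.support] using h }
  have h := HasCircuit.of_layer M
  have h1 : M.gates.length = Fintype.card Q := by simp [M]
  have h2 : M.toMatrix =
      piKron (X := fun _ : Q => Bool) fun q => (U q : Matrix Bool Bool ℂ) := by
    rw [← list_prod_univ_mulSingle fun q => (U q : Matrix Bool Bool ℂ), map_list_prod,
      QACLayer.toMatrix]
    simp only [M, List.map_map]
    congr 2
    funext q
    exact QACGate.toMatrix_single q (U q)
  rwa [h1, h2] at h

/-- Disjointness of the supports lets every gate see the original values of its qubits, so the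
sequential composition acts simultaneously. -/
theorem foldr_toffoliMap_apply {P : Type} (S : P → Finset Q) (t : P → Q)
    (l : List P) (hl : l.Pairwise fun p p' => Disjoint (insert (t p) (S p)) (insert (t p') (S p')))
    (x : Q → Bool) :
    (∀ p ∈ l, (l.foldr (fun p F => toffoliMap (S p) (t p) ∘ F) id) x (t p) =
      xor (x (t p)) (decide (∀ s ∈ S p, x s = true))) ∧
    ∀ q, (∀ p ∈ l, t p ≠ q) →
      (l.foldr (fun p F => toffoliMap (S p) (t p) ∘ F) id) x q = x q := by
  induction l with
  | nil => simp
  | cons p l ih =>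
    rw [List.pairwise_cons] at hl
    obtain ⟨ih1, ih2⟩ := ih hl.2
    have hd : ∀ s ∈ insert (t p) (S p), ∀ p' ∈ l, t p' ≠ s := by
      rintro s hs p' hp' rfl
      exact Finset.disjoint_left.1 (hl.1 p' hp') hs (by simp)
    simp only [List.foldr_cons, Function.comp_apply, toffoliMap]
    constructor
    · intro p' hp'
      rcases List.mem_cons.1 hp' with rfl | hp'
      · rw [Function.update_self, ih2 _ (hd _ (by simp))]
        have : (∀ s ∈ S p', l.foldr (fun p F => toffoliMap (S p) (t p) ∘ F) id x s = true) ↔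
            ∀ s ∈ S p', x s = true :=
          forall₂_congr fun s hs => by rw [ih2 _ (hd s (by simp [hs]))]
        simp only [this]
      · rw [Function.update_of_ne (hd _ (by simp) p' hp')]
        exact ih1 p' hp'
    · intro q hq
      rw [Function.update_of_ne (hq p (by simp)).symm]
      exact ih2 q fun p' hp' => hq p' (by simp [hp'])

/-- A layer of generalized Toffoli gates with disjoint supports. -/
theorem HasCircuit.toffolis {P : Type} [Fintype P] (S : P → Finset Q) (t : P → Q)
    (ht : ∀ p, t p ∉ S p)
    (hd : ∀ p p', p ≠ p' → Disjoint (insert (t p) (S p)) (insert (t p') (S p')))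
    (F : (Q → Bool) → Q → Bool)
    (hF : ∀ x p, F x (t p) = xor (x (t p)) (decide (∀ s ∈ S p, x s = true)))
    (hF' : ∀ x q, (∀ p, t p ≠ q) → F x q = x q) :
    HasCircuit 1 (Fintype.card P) (permMatrix F) := by
  have hpw : (univ : Finset P).toList.Pairwise
      fun p p' => Disjoint (insert (t p) (S p)) (insert (t p') (S p')) :=
    (Finset.nodup_toList univ).imp fun h => hd _ _ h
  let M : QACLayer Q :=
    { gates := (univ : Finset P).toList.map fun p => QACGate.toffoli (S p) (t p) (ht p)
      disjoint := by
        rw [List.pairwise_map]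
        exact hpw }
  have h := HasCircuit.of_layer M
  have h1 : M.gates.length = Fintype.card P := by simp [M]
  have h2 : M.toMatrix = permMatrix F := by
    have hlist : ∀ l : List P,
        ((l.map fun p => QACGate.toffoli (S p) (t p) (ht p)).map QACGate.toMatrix).prod =
          permMatrix (l.foldr (fun p F => toffoliMap (S p) (t p) ∘ F) id) := by
      intro l
      induction l with
      | nil => exact permMatrix_id.symm
      | cons p l ih =>
        rw [List.map_cons, List.map_cons, List.prod_cons, ih, QACGate.toMatrix_toffoli,
          permMatrix_mul, List.foldr_cons]
    rw [QACLayer.toMatrix, hlist]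
    congr 1
    funext x q
    obtain ⟨a1, a2⟩ := foldr_toffoliMap_apply S t _ hpw x
    by_cases hq : ∃ p, t p = q
    · obtain ⟨p, rfl⟩ := hq
      rw [a1 p (by simp), hF]
    · push Not at hq
      rw [a2 q fun p _ => hq p, hF' x q hq]
  rwa [h1, h2] at h

/-- A layer of NOT gates on the qubits in `A`. -/
theorem HasCircuit.nots (A : Finset Q) :
    HasCircuit 1 A.card (permMatrix fun x q => xor (x q) (decide (q ∈ A))) := by
  have := HasCircuit.toffolis (P := A) (fun _ => ∅) (fun q => (q : Q)) (by simp)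
    (fun p p' h => by simpa using Subtype.coe_ne_coe.2 h)
    (fun x q => xor (x q) (decide (q ∈ A))) (fun x p => by simp)
    (fun x q hq => by
      have : q ∉ A := fun h => hq ⟨q, h⟩ rfl
      simp [this])
  simpa using this

/-- A single generalized Toffoli gate. -/
theorem HasCircuit.toffoli (S : Finset Q) (t : Q) (ht : t ∉ S) :
    HasCircuit 1 1 (permMatrix (toffoliMap S t)) := by
  have := HasCircuit.toffolis (P := Unit) (fun _ => S) (fun _ => t) (by simpa using ht)
    (fun p p' h => (h rfl).elim) (toffoliMap S t) (fun x p => by simp [toffoliMap])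
    (fun x q hq => by rw [toffoliMap, Function.update_of_ne (hq ()).symm])
  simpa using this

end HasCircuit

/-! ### Circuits on disjoint registers. -/

section Parallel

variable {J : Type} [Fintype J] [DecidableEq J] {Q : J → Type} [∀ j, Fintype (Q j)]
  [∀ j, DecidableEq (Q j)]

/-- The operator of a family of circuits on disjoint sets of qubits. -/
def tensorMatrix :
    (∀ j, Matrix (Q j → Bool) (Q j → Bool) ℂ) →*
      Matrix ((Σ j, Q j) → Bool) ((Σ j, Q j) → Bool) ℂ :=
  ((Matrix.reindexAlgEquiv ℂ ℂ (Equiv.piCurry fun (j : J) (_ : Q j) => Bool).symm).toMulEquiv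
    : _ →* _).comp piKron

theorem tensorMatrix_apply (A : ∀ j, Matrix (Q j → Bool) (Q j → Bool) ℂ)
    (y x : (Σ j, Q j) → Bool) :
    tensorMatrix A y x = ∏ j, A j (fun q => y ⟨j, q⟩) (fun q => x ⟨j, q⟩) := rfl

theorem tensorMatrix_mulSingle (j : J) (A : Matrix (Q j → Bool) (Q j → Bool) ℂ) :
    tensorMatrix (Pi.mulSingle j A) = liftMatrix (Function.Embedding.sigmaMk j) A := by
  classical
  ext y x
  rw [liftMatrix_apply]
  refine (piKron_mulSingle_apply (X := fun j => Q j → Bool) j A _ _).trans (if_congr ?_ rfl rfl)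
  constructor
  · rintro h ⟨k, q⟩ hr
    refine congrFun (h k ?_) q
    rintro rfl
    exact hr ⟨q, rfl⟩
  · intro h k hk
    funext q
    refine h ⟨k, q⟩ ?_
    rintro ⟨q', hq'⟩
    exact hk (congrArg Sigma.fst hq').symm

theorem HasCircuit.tensor_layer (M : ∀ j, QACLayer (Q j)) :
    HasCircuit 1 (∑ j, (M j).gates.length) (tensorMatrix fun j => (M j).toMatrix) := by
  let N : QACLayer (Σ j, Q j) :=
    { gates := (univ : Finset J).toList.flatMap fun j =>
        ((M j).map (Function.Embedding.sigmaMk j)).gates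
      disjoint := by
        rw [List.pairwise_flatMap]
        refine ⟨fun j _ => ((M j).map _).disjoint, ?_⟩
        refine (Finset.nodup_toList univ).imp fun {j k} h => ?_
        intro g hg g' hg'
        simp only [QACLayer.map, List.mem_map] at hg hg'
        obtain ⟨g, -, rfl⟩ := hg
        obtain ⟨g', -, rfl⟩ := hg'
        rw [QACGate.support_map, QACGate.support_map, Finset.disjoint_left]
        intro q hq hq'
        obtain ⟨a, -, rfl⟩ := Finset.mem_map.1 hq
        obtain ⟨b, -, hb⟩ := Finset.mem_map.1 hq'
        exact h (congrArg Sigma.fst hb).symm }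
  have h := HasCircuit.of_layer N
  have h1 : N.gates.length = ∑ j, (M j).gates.length := by
    simp only [N, List.length_flatMap, QACLayer.map, List.length_map]
    exact Finset.sum_map_toList univ _
  have h2 : N.toMatrix = tensorMatrix fun j => (M j).toMatrix := by
    rw [← list_prod_univ_mulSingle fun j => (M j).toMatrix, map_list_prod, QACLayer.toMatrix]
    simp only [N, List.map_map]
    induction (univ : Finset J).toList with
    | nil => rfl
    | cons j l ih =>
      rw [List.flatMap_cons, List.map_append, List.prod_append, ih, List.map_cons,
        List.prod_cons, Function.comp_apply, tensorMatrix_mulSingle, ← QACLayer.toMatrix_map]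
      rfl
  rwa [h1, h2] at h

/-- Circuits of equal depth are merged by peeling off their first layers together; sizes add, the
depth does not. -/
theorem HasCircuit.tensor {D : ℕ} {G : J → ℕ} {A : ∀ j, Matrix (Q j → Bool) (Q j → Bool) ℂ}
    (h : ∀ j, HasCircuit D (G j) (A j)) : HasCircuit D (∑ j, G j) (tensorMatrix A) := by
  induction D generalizing A G with
  | zero =>
    rw [show A = 1 from funext fun j => (h j).eq_one, map_one]
    exact (HasCircuit.one 0).mono (Nat.zero_le _)
  | succ D ih =>
    choose M G' A' h1 h2 h3 using fun j => (h j).exists_layer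
    have := (ih h1).mul (HasCircuit.tensor_layer M)
    rw [← map_mul, ← Finset.sum_add_distrib, Nat.add_comm] at this
    rw [← show (A' * fun j => (M j).toMatrix) = A from funext h3]
    exact this.mono (Finset.sum_le_sum fun j _ => h2 j)

end Parallel

/-! ### Gadgets and their composition as random processes. -/

section Gadgets

variable {I R L : Type} [Fintype I] [DecidableEq I] [Fintype R] [DecidableEq R] [Fintype L]
  [DecidableEq L]

/-- The operator never changes the qubits in `I` (it only reads them as controls). -/
def ControlOnly (A : Matrix (I ⊕ R → Bool) (I ⊕ R → Bool) ℂ) : Prop :=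
  ∀ y x, A y x ≠ 0 → y ∘ Sum.inl = x ∘ Sum.inl

theorem ControlOnly.mul {A B : Matrix (I ⊕ R → Bool) (I ⊕ R → Bool) ℂ} (hA : ControlOnly A)
    (hB : ControlOnly B) : ControlOnly (A * B) := by
  intro y x h
  rw [Matrix.mul_apply] at h
  obtain ⟨z, -, hz⟩ := Finset.exists_ne_zero_of_sum_ne_zero h
  exact (hA y z (left_ne_zero_of_mul hz)).trans (hB z x (right_ne_zero_of_mul hz))

omit [DecidableEq I] [DecidableEq R] in
theorem ControlOnly.one : ControlOnly (1 : Matrix (I ⊕ R → Bool) (I ⊕ R → Bool) ℂ) := by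
  intro y x h
  rw [Matrix.one_apply, ite_ne_right_iff] at h
  rw [h.1]

omit [DecidableEq I] [DecidableEq R] in
theorem ControlOnly.permMatrix {F : (I ⊕ R → Bool) → I ⊕ R → Bool}
    (hF : ∀ x i, F x (Sum.inl i) = x (Sum.inl i)) : ControlOnly (permMatrix F) := by
  intro y x h
  rw [_root_.permMatrix, Matrix.of_apply, ite_ne_right_iff] at h
  rw [h.1]
  exact funext (hF x)

theorem ControlOnly.piKron {U : I ⊕ R → Matrix Bool Bool ℂ} (hU : ∀ i, U (Sum.inl i) = 1) :
    ControlOnly (piKron (X := fun _ : I ⊕ R => Bool) U) := by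
  intro y x h
  rw [piKron_apply, Finset.prod_ne_zero_iff] at h
  funext i
  have := h (Sum.inl i) (mem_univ _)
  rw [hU, Matrix.one_apply, ite_ne_right_iff] at this
  exact this.1

/-- The probability that measuring the qubit `o` of `A|x⟩|0⟩` yields `b`. -/
noncomputable def outcomeProb (A : Matrix (I ⊕ R → Bool) (I ⊕ R → Bool) ℂ) (o : R) (x : I → Bool)
    (b : Bool) : ℝ :=
  ∑ y : I ⊕ R → Bool with y (Sum.inr o) = b, ‖A y (Sum.elim x fun _ => false)‖ ^ 2

/-- Amplitudes that change the input part vanish, so only the work qubits need to be summed over. -/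
theorem ControlOnly.sum_eq {A : Matrix (I ⊕ R → Bool) (I ⊕ R → Bool) ℂ} (hA : ControlOnly A)
    (x : I → Bool) (g : R → Bool) (φ : (I ⊕ R → Bool) → ℝ) :
    ∑ y, ‖A y (Sum.elim x g)‖ ^ 2 * φ y =
      ∑ r : R → Bool, ‖A (Sum.elim x r) (Sum.elim x g)‖ ^ 2 * φ (Sum.elim x r) := by
  symm
  refine Fintype.sum_of_injective (fun r => Sum.elim x r) ?_ _ _ ?_ fun _ => rfl
  · intro r s h
    simpa using congrArg (fun z => z ∘ Sum.inr) h
  · intro y hy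
    by_contra h
    have h0 : A y (Sum.elim x g) ≠ 0 := by
      intro h0
      simp [h0] at h
    have := hA _ _ h0
    refine hy ⟨y ∘ Sum.inr, ?_⟩
    rw [Sum.elim_comp_inl] at this
    rw [← this]
    exact Sum.elim_comp_inl_inr y

theorem ControlOnly.outcomeProb_eq {A : Matrix (I ⊕ R → Bool) (I ⊕ R → Bool) ℂ}
    (hA : ControlOnly A) (o : R) (x : I → Bool) (b : Bool) :
    outcomeProb A o x b =
      ∑ r : R → Bool, ‖A (Sum.elim x r) (Sum.elim x fun _ => false)‖ ^ 2 *
        if r o = b then 1 else 0 := by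
  have := hA.sum_eq x (fun _ => false) fun y => if y (Sum.inr o) = b then 1 else 0
  rw [outcomeProb, Finset.sum_filter]
  refine Eq.trans (Finset.sum_congr rfl fun y _ => ?_) this
  split_ifs <;> simp

/-- There is a QAC circuit of depth `D` whose number of gates and qubits is at most `S` which only
reads the input bits `I` and whose output qubit yields `b` with probability `P x b`. -/
def IsGadget (I : Type) [Fintype I] [DecidableEq I] (D S : ℕ) (P : (I → Bool) → Bool → ℝ) : Prop :=
  ∃ (R : Type) (_ : Fintype R) (_ : DecidableEq R) (o : R)
    (A : Matrix (I ⊕ R → Bool) (I ⊕ R → Bool) ℂ) (G : ℕ),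
    HasCircuit D G A ∧ G + Fintype.card (I ⊕ R) ≤ S ∧ ControlOnly A ∧
      ∀ x b, P x b = outcomeProb A o x b

variable {D D' S S' : ℕ} {P P' : (I → Bool) → Bool → ℝ}

theorem IsGadget.nonneg (h : IsGadget I D S P) (x : I → Bool) (b : Bool) : 0 ≤ P x b := by
  obtain ⟨R, _, _, o, A, G, -, -, -, hP⟩ := h
  rw [hP]
  exact Finset.sum_nonneg fun _ _ => by positivity

theorem IsGadget.add_eq_one (h : IsGadget I D S P) (x : I → Bool) :
    P x true + P x false = 1 := by
  obtain ⟨R, _, _, o, A, G, hA, -, -, hP⟩ := h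
  rw [hP, hP, outcomeProb, outcomeProb, ← hA.sum_norm_sq (Sum.elim x fun _ => false),
    ← Finset.sum_filter_add_sum_filter_not univ fun y : I ⊕ R → Bool => y (Sum.inr o) = true]
  simp

theorem IsGadget.le_one (h : IsGadget I D S P) (x : I → Bool) (b : Bool) : P x b ≤ 1 := by
  have h1 := h.add_eq_one x
  have h2 := h.nonneg x true
  have h3 := h.nonneg x false
  cases b <;> linarith

theorem IsGadget.congr (h : IsGadget I D S P) (hP : ∀ x b, P x b = P' x b) :
    IsGadget I D S P' := by
  rwa [← show P = P' from funext₂ hP]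

theorem IsGadget.mono (h : IsGadget I D S P) (hD : D ≤ D') (hS : S ≤ S') :
    IsGadget I D' S' P := by
  obtain ⟨R, _, _, o, A, G, hA, hG, hc, hP⟩ := h
  refine ⟨R, _, _, o, A, G, ?_, hG.trans hS, hc, hP⟩
  have := (HasCircuit.one (D' - D)).mul hA
  rw [one_mul] at this
  rwa [add_zero, Nat.add_sub_cancel' hD] at this

theorem liftMatrix_equiv_apply {Q Q' : Type} [Fintype Q] [Fintype Q'] [DecidableEq Q]
    [DecidableEq Q'] (e : Q ≃ Q') (A : Matrix (Q → Bool) (Q → Bool) ℂ) (y x : Q' → Bool) :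
    liftMatrix e.toEmbedding A y x = A (y ∘ e) (x ∘ e) := by
  classical
  rw [liftMatrix_apply, if_pos]
  · rfl
  · intro r hr
    exact (hr ⟨e.symm r, by simp⟩).elim

/-- `B` leaves the qubits of `Q` that it reads unchanged, and `A` does not touch `R`. Hence a single
intermediate state contributes, with its `Q` part already final, and the amplitude factors. -/
theorem liftMatrix_mul_liftMatrix_apply {Q : Type} [Fintype Q] [DecidableEq Q]
    (A : Matrix (Q → Bool) (Q → Bool) ℂ) {B : Matrix (L ⊕ R → Bool) (L ⊕ R → Bool) ℂ}
    (hB : ControlOnly B) (e : L ↪ Q) (y x : Q ⊕ R → Bool) :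
    (liftMatrix (e.sumMap (Function.Embedding.refl R)) B *
        liftMatrix (Function.Embedding.inl : Q ↪ Q ⊕ R) A) y x =
      A (y ∘ Sum.inl) (x ∘ Sum.inl) *
        B (Sum.elim (y ∘ Sum.inl ∘ e) (y ∘ Sum.inr)) (Sum.elim (y ∘ Sum.inl ∘ e) (x ∘ Sum.inr)) := by
  classical
  have hr1 : ∀ r : R, (Sum.inr r : Q ⊕ R) ∉ Set.range (Function.Embedding.inl : Q ↪ Q ⊕ R) := by
    rintro r ⟨q, hq⟩
    cases hq
  have hr2 : ∀ r : R,
      (Sum.inr r : Q ⊕ R) ∈ Set.range (e.sumMap (Function.Embedding.refl R)) :=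
    fun r => ⟨Sum.inr r, rfl⟩
  rw [Matrix.mul_apply, Fintype.sum_eq_single (Sum.elim (y ∘ Sum.inl) (x ∘ Sum.inr))]
  · rw [mul_comm, liftMatrix_apply, liftMatrix_apply, if_pos, if_pos]
    · congr 1
      congr 1
      · funext q
        rcases q with q | q <;> rfl
      · funext q
        rcases q with q | q <;> rfl
    · rintro (q | q) hq
      · rfl
      · exact (hq (hr2 q)).elim
    · rintro (q | q) hq
      · exact (hq ⟨q, rfl⟩).elim
      · rfl
  · intro z hz
    by_contra h
    have h1 := left_ne_zero_of_mul h
    have h2 := right_ne_zero_of_mul h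
    rw [liftMatrix_apply, ite_ne_right_iff] at h1 h2
    have h3 := hB _ _ h1.2
    refine hz (funext fun q => ?_)
    rcases q with q | q
    · by_cases hq : (Sum.inl q : Q ⊕ R) ∈ Set.range (e.sumMap (Function.Embedding.refl R))
      · obtain ⟨l | r, hl⟩ := hq
        · have := congrFun h3 l
          simp only [Function.comp_apply, hl] at this
          exact this.symm
        · cases hl
      · exact (h1.1 _ hq).symm
    · exact h2.1 _ (hr1 q)

/-- Deferred measurement: squaring the factored amplitudes gives the law obtained by measuring the
qubits after `A` and running `B` on the result. This is why garbage never has to be uncomputed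
between gadgets. -/
theorem outcomeProb_seq {R' : Type} [Fintype R'] [DecidableEq R']
    {A : Matrix (I ⊕ R → Bool) (I ⊕ R → Bool) ℂ}
    {B : Matrix (L ⊕ R' → Bool) (L ⊕ R' → Bool) ℂ} (hB : ControlOnly B) (e : L ↪ I ⊕ R) (o : R')
    (x : I → Bool) (b : Bool) :
    outcomeProb (liftMatrix (Equiv.sumAssoc I R R').toEmbedding
      (liftMatrix (e.sumMap (Function.Embedding.refl R')) B *
        liftMatrix (Function.Embedding.inl : I ⊕ R ↪ (I ⊕ R) ⊕ R') A)) (Sum.inr o) x b =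
    ∑ y, ‖A y (Sum.elim x fun _ => false)‖ ^ 2 * outcomeProb B o (y ∘ e) b := by
  have hE : ∑ p : (I ⊕ R → Bool) × (R' → Bool),
      (if p.2 o = b then ‖A p.1 (Sum.elim x fun _ => false) *
        B (Sum.elim (p.1 ∘ e) p.2) (Sum.elim (p.1 ∘ e) fun _ => false)‖ ^ 2 else 0) =
      ∑ y : I ⊕ (R ⊕ R') → Bool, if y (Sum.inr (Sum.inr o)) = b then
        ‖liftMatrix (Equiv.sumAssoc I R R').toEmbedding
        (liftMatrix (e.sumMap (Function.Embedding.refl R')) B *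
        liftMatrix (Function.Embedding.inl : I ⊕ R ↪ (I ⊕ R) ⊕ R') A) y
          (Sum.elim x fun _ => false)‖ ^ 2 else 0 := by
    refine Fintype.sum_equiv ((Equiv.sumArrowEquivProdArrow _ _ _).symm.trans
      ((Equiv.sumAssoc I R R').arrowCongr (Equiv.refl _))) _ _ ?_
    rintro ⟨y, r⟩
    rw [liftMatrix_equiv_apply, liftMatrix_mul_liftMatrix_apply A hB e]
    have h1 : (Sum.elim x fun _ : R ⊕ R' => false) ∘ ⇑(Equiv.sumAssoc I R R') =
        Sum.elim (Sum.elim x fun _ => false) fun _ => false := by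
      funext q
      rcases q with (q | q) | q <;> rfl
    have h3 : ((Equiv.sumArrowEquivProdArrow _ _ _).symm.trans
        ((Equiv.sumAssoc I R R').arrowCongr (Equiv.refl _))) (y, r) ∘ (Equiv.sumAssoc I R R') =
        Sum.elim y r := by
      funext q
      simp [Equiv.arrowCongr]
      rfl
    rw [h1, h3]
    refine if_congr ?_ rfl rfl
    exact (congrArg (· = b) (congrFun h3 (Sum.inr o))).symm.to_iff
  rw [outcomeProb, Finset.sum_filter, ← hE, Fintype.sum_prod_type]
  refine Finset.sum_congr rfl fun y _ => ?_
  rw [hB.outcomeProb_eq, Finset.mul_sum]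
  refine Finset.sum_congr rfl fun r _ => ?_
  split_ifs
  · rw [norm_mul, mul_pow, mul_one]
  · simp

/-- Running a gadget that reads some of the qubits after a circuit. -/
theorem IsGadget.seq {G : ℕ} {A : Matrix (I ⊕ R → Bool) (I ⊕ R → Bool) ℂ}
    (hA : HasCircuit D G A) (hc : ControlOnly A) {PB : (L → Bool) → Bool → ℝ}
    (hB : IsGadget L D' S' PB) (e : L ↪ I ⊕ R) :
    IsGadget I (D + D') (G + Fintype.card (I ⊕ R) + S')
      (fun x b => ∑ y, ‖A y (Sum.elim x fun _ => false)‖ ^ 2 * PB (y ∘ e) b) := by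
  obtain ⟨R', _, _, o, B, G', hB, hG, hcB, hP⟩ := hB
  refine ⟨R ⊕ R', inferInstance, inferInstance, Sum.inr o,
    liftMatrix (Equiv.sumAssoc I R R').toEmbedding
      (liftMatrix (e.sumMap (Function.Embedding.refl R')) B *
        liftMatrix (Function.Embedding.inl : I ⊕ R ↪ (I ⊕ R) ⊕ R') A), _,
    ((hB.lift (e.sumMap (Function.Embedding.refl R'))).mul
      (hA.lift (Function.Embedding.inl : I ⊕ R ↪ (I ⊕ R) ⊕ R'))).lift _, ?_, ?_, ?_⟩
  · simp only [Fintype.card_sum] at hG ⊢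
    omega
  · intro y x h
    rw [liftMatrix_equiv_apply, liftMatrix_mul_liftMatrix_apply A hcB e] at h
    exact hc _ _ (left_ne_zero_of_mul h)
  · intro x b
    rw [outcomeProb_seq hcB]
    simp only [hP]

/-- Reading the inputs from a larger set of input bits. -/
theorem IsGadget.mapInputs (h : IsGadget I D S P) (e : I ↪ L) :
    IsGadget L D (Fintype.card L + S) (fun x b => P (x ∘ e) b) := by
  -- The preceding circuit is empty; it only introduces the additional input qubits.
  have := IsGadget.seq (R := Empty) (HasCircuit.one 0) ControlOnly.one h
    (e.trans (Function.Embedding.inl : L ↪ L ⊕ Empty))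
  simp only [zero_add, Fintype.card_sum, Fintype.card_empty, add_zero] at this
  refine this.congr fun x b => ?_
  rw [Fintype.sum_eq_single (Sum.elim x fun _ => false)]
  · rw [Matrix.one_apply_eq]
    simp only [norm_one, one_pow, one_mul]
    rfl
  · intro y hy
    rw [Matrix.one_apply_ne hy]
    simp

section Parallel

variable {J : Type} [Fintype J] [DecidableEq J] {I R : J → Type} [∀ j, Fintype (I j)]
  [∀ j, DecidableEq (I j)] [∀ j, Fintype (R j)] [∀ j, DecidableEq (R j)]

/-- `tensorMatrix`, with all the inputs collected. -/
noncomputable def parallelMatrix (A : ∀ j, Matrix (I j ⊕ R j → Bool) (I j ⊕ R j → Bool) ℂ) :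
    Matrix ((Σ j, I j) ⊕ (Σ j, R j) → Bool) ((Σ j, I j) ⊕ (Σ j, R j) → Bool) ℂ :=
  liftMatrix (Equiv.sigmaSumDistrib I R).toEmbedding (tensorMatrix A)

theorem parallelMatrix_apply (A : ∀ j, Matrix (I j ⊕ R j → Bool) (I j ⊕ R j → Bool) ℂ)
    (y x : (Σ j, I j) ⊕ (Σ j, R j) → Bool) :
    parallelMatrix A y x =
      ∏ j, A j (fun q => y (Equiv.sigmaSumDistrib I R ⟨j, q⟩))
        (fun q => x (Equiv.sigmaSumDistrib I R ⟨j, q⟩)) := by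
  rw [parallelMatrix, liftMatrix_equiv_apply, tensorMatrix_apply]
  rfl

theorem ControlOnly.parallel {A : ∀ j, Matrix (I j ⊕ R j → Bool) (I j ⊕ R j → Bool) ℂ}
    (hA : ∀ j, ControlOnly (A j)) : ControlOnly (parallelMatrix A) := by
  intro y x h
  rw [parallelMatrix_apply, Finset.prod_ne_zero_iff] at h
  funext ⟨j, i⟩
  exact congrFun (hA j _ _ (h j (mem_univ _))) i

/-- Amplitudes multiply over `j`, so the output bits are independent; grouping the final states by
their outputs `z` exposes the product law. -/
theorem sum_parallelMatrix (A : ∀ j, Matrix (I j ⊕ R j → Bool) (I j ⊕ R j → Bool) ℂ)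
    (o : ∀ j, R j) (x : (Σ j, I j) → Bool) (φ : (J → Bool) → ℝ) :
    ∑ y, ‖parallelMatrix A y (Sum.elim x fun _ => false)‖ ^ 2 *
        φ (fun j => y (Sum.inr ⟨j, o j⟩)) =
      ∑ z : J → Bool, (∏ j, outcomeProb (A j) (o j) (fun i => x ⟨j, i⟩) (z j)) * φ z := by
  have hE : ∑ p : ∀ j, I j ⊕ R j → Bool,
      (∏ j, ‖A j (p j) (Sum.elim (fun i => x ⟨j, i⟩) fun _ => false)‖ ^ 2) *
        φ (fun j => p j (Sum.inr (o j))) =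
      ∑ y, ‖parallelMatrix A y (Sum.elim x fun _ => false)‖ ^ 2 *
        φ (fun j => y (Sum.inr ⟨j, o j⟩)) := by
    refine Fintype.sum_equiv ((Equiv.piCurry fun (j : J) (_ : I j ⊕ R j) => Bool).symm.trans
      ((Equiv.sigmaSumDistrib I R).arrowCongr (Equiv.refl _))) _ _ fun p => ?_
    rw [parallelMatrix_apply, norm_prod, ← Finset.prod_pow]
    refine congrArg₂ (· * ·) (Finset.prod_congr rfl fun j _ => ?_) rfl
    congr 3
    · funext q
      rcases q with q | q <;> rfl
    · funext q
      rcases q with q | q <;> rfl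
  rw [← hE]
  simp only [outcomeProb, Finset.prod_univ_sum, Finset.sum_mul]
  rw [← Finset.sum_fiberwise univ fun p : ∀ j, I j ⊕ R j → Bool => fun j => p j (Sum.inr (o j))]
  refine Finset.sum_congr rfl fun z _ => ?_
  have : Fintype.piFinset (fun j => univ.filter fun y : I j ⊕ R j → Bool =>
      y (Sum.inr (o j)) = z j) =
      univ.filter fun p : ∀ j, I j ⊕ R j → Bool => (fun j => p j (Sum.inr (o j))) = z := by
    ext p
    simp [funext_iff]
  rw [this]
  refine Finset.sum_congr rfl fun p hp => ?_
  rw [(Finset.mem_filter.1 hp).2]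

/-- Feeding the outputs of a family of gadgets on independent inputs into a gadget. -/
theorem IsGadget.comp {S : J → ℕ} {P : ∀ j, (I j → Bool) → Bool → ℝ}
    (h : ∀ j, IsGadget (I j) D (S j) (P j)) {PB : (J → Bool) → Bool → ℝ}
    (hB : IsGadget J D' S' PB) :
    IsGadget (Σ j, I j) (D + D') (∑ j, S j + S')
      (fun x b => ∑ z, (∏ j, P j (fun i => x ⟨j, i⟩) (z j)) * PB z b) := by
  choose R i1 i2 o A G h1 h2 h3 h4 using h
  let e : J ↪ (Σ j, I j) ⊕ Σ j, R j :=
    ⟨fun j => Sum.inr ⟨j, o j⟩, fun j k hjk => by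
      simpa using congrArg Sigma.fst (Sum.inr_injective hjk)⟩
  have := IsGadget.seq ((HasCircuit.tensor h1).lift (Equiv.sigmaSumDistrib I R).toEmbedding)
    (ControlOnly.parallel h3) hB e
  refine (this.mono le_rfl ?_).congr fun x b => ?_
  · simp only [Fintype.card_sum, Fintype.card_sigma] at h2 ⊢
    have := Finset.sum_le_sum fun j (_ : j ∈ univ) => h2 j
    simp only [Finset.sum_add_distrib] at this
    omega
  · simp only [h4]
    exact sum_parallelMatrix A o x fun z => PB z b

end Parallel

end Gadgets

/-! ### Deterministic gadgets: AND and OR. -/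

section ClassicalGadgets

variable {I R J : Type} [Fintype I] [DecidableEq I] [Fintype R] [DecidableEq R] [Fintype J]
  [DecidableEq J]

/-- The probability that a bit which is surely `v` takes the value `b`. -/
def pointProb (v b : Bool) : ℝ := if v = b then 1 else 0

theorem IsGadget.of_permMatrix {D G : ℕ} {F : (I ⊕ R → Bool) → I ⊕ R → Bool}
    (h : HasCircuit D G (permMatrix F)) (hF : ∀ x i, F x (Sum.inl i) = x (Sum.inl i)) (o : R) :
    IsGadget I D (G + Fintype.card (I ⊕ R))
      (fun x b => pointProb (F (Sum.elim x fun _ => false) (Sum.inr o)) b) := by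
  refine ⟨R, _, _, o, _, G, h, le_rfl, ControlOnly.permMatrix hF, fun x b => ?_⟩
  rw [outcomeProb, Finset.sum_filter, Fintype.sum_eq_single (F (Sum.elim x fun _ => false))]
  · simp [permMatrix, pointProb]
  · intro y hy
    simp [permMatrix, hy]

theorem isGadget_and (J : Type) [Fintype J] [DecidableEq J] :
    IsGadget J 3 (3 * Fintype.card J + 3)
      (fun z b => pointProb (decide (∀ j, z j = true)) b) := by
  have h := IsGadget.of_permMatrix (I := J) (R := Unit)
    (HasCircuit.toffoli (univ.map Function.Embedding.inl) (Sum.inr ()) (by simp))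
    (by simp [toffoliMap]) ()
  refine (h.mono (by norm_num) ?_).congr fun x b => ?_
  · simp only [Fintype.card_sum, Fintype.card_unit]
    omega
  · simp [toffoliMap]

theorem isGadget_or (J : Type) [Fintype J] [DecidableEq J] :
    IsGadget J 3 (3 * Fintype.card J + 3)
      (fun z b => pointProb (decide (∃ j, z j = true)) b) := by
  -- De Morgan. The first layer of NOTs also flips the target, which accounts for the outer
  -- negation; the last layer restores the inputs.
  have h := ((HasCircuit.nots (univ.map (Function.Embedding.inl : J ↪ J ⊕ Unit))).mul
    (HasCircuit.toffoli (univ.map Function.Embedding.inl) (Sum.inr ()) (by simp))).mul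
    (HasCircuit.nots (univ : Finset (J ⊕ Unit)))
  rw [permMatrix_mul, permMatrix_mul] at h
  refine ((IsGadget.of_permMatrix h (by simp [toffoliMap]) ()).mono (by norm_num) ?_).congr
    fun x b => ?_
  · simp only [Fintype.card_sum, Fintype.card_unit, Finset.card_map, Finset.card_univ]
    omega
  · congr 1
    simp only [toffoliMap, Function.comp_apply, Function.update_self]
    by_cases hx : ∃ j, x j = true
    · have : ¬ ∀ j, x j = false := by simpa using hx
      simp [hx, this]
    · have : ∀ j, x j = false := by simpa using hx
      simp [this]

end ClassicalGadgets

/-! ### Real one-qubit rotations. -/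

section Rotation

/-- A real rotation of one qubit. -/
noncomputable def qubitRotation (c s : ℝ) (h : c ^ 2 + s ^ 2 = 1) : Matrix.unitaryGroup Bool ℂ :=
  ⟨Matrix.of fun y x => if y = x then (c : ℂ) else if x then (s : ℂ) else -(s : ℂ), by
    have h' : (c : ℂ) ^ 2 + (s : ℂ) ^ 2 = 1 := by exact_mod_cast h
    rw [Matrix.mem_unitaryGroup_iff]
    ext y x
    simp only [Matrix.mul_apply, Fintype.sum_bool, Matrix.star_apply, Matrix.of_apply]
    cases y <;> cases x <;> simp <;> first | ring1 | linear_combination h'⟩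

variable {c s : ℝ} (h : c ^ 2 + s ^ 2 = 1)

theorem qubitRotation_false_false : (qubitRotation c s h : Matrix Bool Bool ℂ) false false = c := by
  simp [qubitRotation]

theorem qubitRotation_false_true : (qubitRotation c s h : Matrix Bool Bool ℂ) false true = s := by
  simp [qubitRotation]

/-- The contribution of the path `0 → b → 0` is the probability of `b`. Rotating a coin forth and
back thus turns amplitudes into averages over coin values. -/
theorem star_qubitRotation_mul (b : Bool) :
    (star (qubitRotation c s h) : Matrix Bool Bool ℂ) false b *
        (qubitRotation c s h : Matrix Bool Bool ℂ) b false =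
      ((if b then s ^ 2 else c ^ 2 : ℝ) : ℂ) := by
  cases b <;> simp [qubitRotation] <;> ring

end Rotation

/-! ### The quantum weight test. -/

section WeightTest

variable {ι : Type} [Fintype ι] [DecidableEq ι]

/-- The work qubits of the weight test: for every input bit a coin and the product of the coin
with the input bit, and one further qubit. -/
abbrev TestWires (ι : Type) : Type := (ι ⊕ ι) ⊕ Unit

/-- The assignment with given inputs and coins, and with all other qubits `0`. -/
def coinAssignment (x b : ι → Bool) : ι ⊕ TestWires ι → Bool :=
  Sum.elim x (Sum.elim (Sum.elim b fun _ => false) fun _ => false)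

/-- Add the products of coins and inputs to their wires. -/
def coinProducts (z : ι ⊕ TestWires ι → Bool) : ι ⊕ TestWires ι → Bool
  | Sum.inr (Sum.inl (Sum.inr i)) =>
    xor (z (Sum.inr (Sum.inl (Sum.inr i)))) (z (Sum.inl i) && z (Sum.inr (Sum.inl (Sum.inl i))))
  | q => z q

/-- Flip the last qubit if all products of coins and inputs vanish. -/
def coinTest (z : ι ⊕ TestWires ι → Bool) : ι ⊕ TestWires ι → Bool :=
  Function.update z (Sum.inr (Sum.inr ())) (xor (z (Sum.inr (Sum.inr ())))
    (decide (∀ i, xor (z (Sum.inr (Sum.inl (Sum.inr i))))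
      (z (Sum.inl i) && z (Sum.inr (Sum.inl (Sum.inl i)))) = false)))

theorem hasCircuit_coinProducts :
    HasCircuit 1 (Fintype.card ι) (permMatrix (coinProducts (ι := ι))) := by
  refine HasCircuit.toffolis
    (fun i => {Sum.inl i, Sum.inr (Sum.inl (Sum.inl i))})
    (fun i => Sum.inr (Sum.inl (Sum.inr i))) (by simp) (fun i j hij => ?_) _ (fun x i => ?_)
    fun x q hq => ?_
  · simp [hij.symm]
  · simp [coinProducts]
  · rcases q with q | (q | q) | q <;> simp_all [coinProducts]

theorem hasCircuit_coinTest :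
    HasCircuit 5 (4 * Fintype.card ι + 1) (permMatrix (coinTest (ι := ι))) := by
  let P : Finset (ι ⊕ TestWires ι) := univ.image fun i => Sum.inr (Sum.inl (Sum.inr i))
  have hP : P.card ≤ Fintype.card ι := Finset.card_image_le
  have hn := (HasCircuit.nots P).mono hP
  -- Compute the products, test by a negated Toffoli whether all vanish, then undo negations and
  -- products. The uncomputation is essential: leftover products would prevent the coin paths from
  -- interfering.
  have h := (((hasCircuit_coinProducts (ι := ι)).mul hn).mul
    (HasCircuit.toffoli P (Sum.inr (Sum.inr ())) (by simp [P]))).mul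
      (hn.mul hasCircuit_coinProducts)
  simp only [permMatrix_mul] at h
  convert h.mono (G' := 4 * Fintype.card ι + 1) (by omega) using 2
  funext z q
  rcases q with q | (q | q) | q <;>
    simp [coinTest, coinProducts, toffoliMap, P]

/-- The preparation of the coins. -/
noncomputable def coinPrepare (U : Matrix.unitaryGroup Bool ℂ) :
    ι ⊕ TestWires ι → Matrix.unitaryGroup Bool ℂ
  | Sum.inr (Sum.inl (Sum.inl _)) => U
  | _ => 1

/-- The inverse of the preparation of the coins, and an operation on the last qubit. -/
noncomputable def coinReturn (U W : Matrix.unitaryGroup Bool ℂ) :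
    ι ⊕ TestWires ι → Matrix.unitaryGroup Bool ℂ
  | Sum.inr (Sum.inl (Sum.inl _)) => star U
  | Sum.inr (Sum.inr _) => W
  | _ => 1

/-- The operator of the weight test. -/
noncomputable def weightTestMatrix (ι : Type) [Fintype ι] [DecidableEq ι]
    (U W : Matrix.unitaryGroup Bool ℂ) :
    Matrix (ι ⊕ TestWires ι → Bool) (ι ⊕ TestWires ι → Bool) ℂ :=
  piKron (X := fun _ : ι ⊕ TestWires ι => Bool) (fun q => (coinReturn U W q : Matrix Bool Bool ℂ)) *
    permMatrix coinTest *
    piKron (X := fun _ : ι ⊕ TestWires ι => Bool) (fun q => (coinPrepare U q : Matrix Bool Bool ℂ))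

theorem hasCircuit_weightTestMatrix (U W : Matrix.unitaryGroup Bool ℂ) :
    HasCircuit 7 (10 * Fintype.card ι + 3) (weightTestMatrix ι U W) := by
  refine (((HasCircuit.singleQubits (coinReturn U W)).mul hasCircuit_coinTest).mul
    (HasCircuit.singleQubits (coinPrepare U))).mono ?_
  simp only [Fintype.card_sum, Fintype.card_unit]
  omega

theorem controlOnly_weightTestMatrix (U W : Matrix.unitaryGroup Bool ℂ) :
    ControlOnly (weightTestMatrix ι U W) := by
  refine ((ControlOnly.piKron fun i => ?_).mul (ControlOnly.permMatrix fun x i => ?_)).mul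
    (ControlOnly.piKron fun i => ?_)
  · rfl
  · simp [coinTest]
  · rfl

/-- The middle operator fixes the coins and restores the products. The paths from all-zero work
qubits back to themselves are therefore indexed by the coin values `b`, with `W` acting on a flag
that depends on `x` and `b`. -/
theorem weightTestMatrix_apply (U W : Matrix.unitaryGroup Bool ℂ) (x : ι → Bool) :
    weightTestMatrix ι U W (coinAssignment x fun _ => false) (coinAssignment x fun _ => false) =
      ∑ b : ι → Bool, (∏ i, (star U : Matrix Bool Bool ℂ) false (b i) *
        (U : Matrix Bool Bool ℂ) (b i) false) *
        (W : Matrix Bool Bool ℂ) false (decide (∀ i, (x i && b i) = false)) := by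
  rw [weightTestMatrix, Matrix.mul_apply]
  symm
  refine Fintype.sum_of_injective (coinAssignment x) (fun b b' h => ?_) _ _ (fun z hz => ?_)
    fun b => ?_
  · funext i
    exact congrFun h (Sum.inr (Sum.inl (Sum.inl i)))
  · by_contra h
    have h0 := right_ne_zero_of_mul h
    rw [piKron_apply, Finset.prod_ne_zero_iff] at h0
    refine hz ⟨fun i => z (Sum.inr (Sum.inl (Sum.inl i))), funext fun q => ?_⟩
    have hq := h0 q (mem_univ _)
    have hone : ∀ a b : Bool, ((1 : Matrix.unitaryGroup Bool ℂ) : Matrix Bool Bool ℂ) a b ≠ 0 →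
        a = b := by
      intro a b hab
      by_contra hne
      exact hab (Matrix.one_apply_ne hne)
    rcases q with q | (q | q) | q
    · exact (hone _ _ hq).symm
    · rfl
    · exact (hone _ _ hq).symm
    · exact (hone _ _ hq).symm
  · rw [mul_permMatrix_apply, piKron_apply, piKron_apply]
    simp only [Fintype.prod_sum_type]
    simp [coinTest, coinAssignment, coinPrepare, coinReturn, Finset.prod_mul_distrib]
    ring

/-- An expectation over independent coins: all products vanish iff the coins at the ones of `x` are
all 0, which has weight `p false ^ |x|`. -/
theorem sum_prod_coins (p : Bool → ℂ) (hp : p false + p true = 1) (u₀ u₁ : ℂ) (x : ι → Bool) :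
    ∑ b : ι → Bool, (∏ i, p (b i)) *
        (if ∀ i, (x i && b i) = false then u₁ else u₀) =
      u₀ * (1 - p false ^ hammingWeight x) + u₁ * p false ^ hammingWeight x := by
  have h1 : ∑ b : ι → Bool, ∏ i, p (b i) = 1 := by
    rw [← Fintype.prod_sum]
    simp [add_comm, hp]
  have h2 : ∑ b : ι → Bool, (∏ i, p (b i)) * (if ∀ i, (x i && b i) = false then 1 else 0) =
      p false ^ hammingWeight x := by
    have : ∀ b : ι → Bool, (∏ i, p (b i)) * (if ∀ i, (x i && b i) = false then 1 else 0) =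
        ∏ i, if (x i && b i) = false then p (b i) else 0 := by
      intro b
      split_ifs with h
      · rw [mul_one]
        exact Finset.prod_congr rfl fun i _ => (if_pos (h i)).symm
      · push Not at h
        obtain ⟨i, hi⟩ := h
        rw [mul_zero, Finset.prod_eq_zero (mem_univ i) (if_neg hi)]
    simp only [this]
    rw [← Fintype.prod_sum fun i (b : Bool) => if (x i && b) = false then p b else 0]
    have h3 : ∀ i, (∑ b : Bool, if (x i && b) = false then p b else 0) =
        if x i = true then p false else 1 := by
      intro i
      cases x i <;> simp [add_comm, hp]
    simp only [h3]
    rw [Finset.prod_ite]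
    simp [hammingWeight]
  have h3 : ∀ b : ι → Bool, (∏ i, p (b i)) * (if ∀ i, (x i && b i) = false then u₁ else u₀) =
      (∏ i, p (b i)) * u₀ +
        (∏ i, p (b i)) * (if ∀ i, (x i && b i) = false then 1 else 0) * (u₁ - u₀) := by
    intro b
    split_ifs <;> ring
  simp only [h3, Finset.sum_add_distrib, ← Finset.sum_mul, h1, h2]
  ring

/-- A gadget whose output is surely `1` on inputs of weight `k`, and which yields `0` with
noticeable probability on all other inputs. -/
theorem exists_isGadget_weightTest (ι : Type) [Fintype ι] [DecidableEq ι] (r : ℝ) (hr : 0 ≤ r)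
    (hr' : r ≤ 1) (k : ℕ) :
    ∃ P, IsGadget ι 10 (19 * Fintype.card ι + 11) P ∧ ∀ x, P x false =
      (r ^ k - r ^ hammingWeight x) ^ 2 / ((r ^ k) ^ 2 + (1 - r ^ k) ^ 2) := by
  -- `ν` normalizes the vector `(r ^ k, -(1 - r ^ k))`, which is to become the first row of `W`.
  have hν : 0 < (r ^ k) ^ 2 + (1 - r ^ k) ^ 2 := by nlinarith [sq_nonneg (2 * r ^ k - 1)]
  set ν := (r ^ k) ^ 2 + (1 - r ^ k) ^ 2 with hνdef
  have hsq : √ν ^ 2 = ν := Real.sq_sqrt hν.le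
  have hU : √r ^ 2 + √(1 - r) ^ 2 = 1 := by
    rw [Real.sq_sqrt hr, Real.sq_sqrt (by linarith)]; ring
  have hW : (r ^ k / √ν) ^ 2 + (-(1 - r ^ k) / √ν) ^ 2 = 1 := by
    rw [div_pow, div_pow, hsq, ← add_div, neg_sq, ← hνdef, div_self hν.ne']
  let U := qubitRotation _ _ hU
  let W := qubitRotation _ _ hW
  -- The OR is 0 exactly if all work qubits are back at 0, so the probability of outcome 0 is one
  -- squared amplitude.
  have h := IsGadget.seq (hasCircuit_weightTestMatrix (ι := ι) U W)
    (controlOnly_weightTestMatrix U W) (isGadget_or (TestWires ι)) Function.Embedding.inr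
  refine ⟨_, h.mono (by norm_num) ?_, fun x => ?_⟩
  · simp only [Fintype.card_sum, Fintype.card_unit]
    omega
  · have hx : (Sum.elim x fun _ => false : ι ⊕ TestWires ι → Bool) =
        coinAssignment x fun _ => false := by
      funext q
      rcases q with q | (q | q) | q <;> rfl
    rw [(controlOnly_weightTestMatrix U W).sum_eq,
      Fintype.sum_eq_single (fun _ : TestWires ι => false)]
    · have h1 : pointProb (decide (∃ j, (Sum.elim x (fun _ : TestWires ι => false) ∘
          Function.Embedding.inr) j = true)) false = 1 := by
        simp [pointProb]
      rw [h1, mul_one, hx, weightTestMatrix_apply]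
      have h2 : ∀ b : Bool, (W : Matrix Bool Bool ℂ) false b =
          if b = true then ((-(1 - r ^ k) / √ν : ℝ) : ℂ) else ((r ^ k / √ν : ℝ) : ℂ) := by
        intro b
        cases b
        · exact qubitRotation_false_false hW
        · exact qubitRotation_false_true hW
      simp only [U, star_qubitRotation_mul, h2, decide_eq_true_eq]
      rw [sum_prod_coins (fun b => ((if b then √(1 - r) ^ 2 else √r ^ 2 : ℝ) : ℂ))
        (by exact_mod_cast hU)]
      have h3 : ((if false = true then √(1 - r) ^ 2 else √r ^ 2 : ℝ) : ℂ) = (r : ℂ) := by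
        simp [Real.sq_sqrt hr]
      rw [h3]
      have h4 : ((r ^ k / √ν : ℝ) : ℂ) * (1 - (r : ℂ) ^ hammingWeight x) +
          ((-(1 - r ^ k) / √ν : ℝ) : ℂ) * (r : ℂ) ^ hammingWeight x =
          (((r ^ k - r ^ hammingWeight x) / √ν : ℝ) : ℂ) := by
        push_cast
        ring
      rw [h4, Complex.norm_real, Real.norm_eq_abs, sq_abs, div_pow, hsq]
    · intro g hg
      have : ∃ j, g j = true := by
        by_contra! hne
        exact hg (funext fun j => by simpa using hne j)
      have h1 : pointProb (decide (∃ j, (Sum.elim x g ∘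
          Function.Embedding.inr) j = true)) false = 0 := by
        simp [pointProb, this]
      rw [h1, mul_zero]

end WeightTest

/-! ### Approximation of partial specifications and the union bound. -/

section Approximation

variable {I : Type} [Fintype I] [DecidableEq I]

/-- There is a gadget which yields `b` with probability at least `1 - ε` on every input `x` with
`V x b`. -/
def Approximates (I : Type) [Fintype I] [DecidableEq I] (D S : ℕ) (ε : ℝ)
    (V : (I → Bool) → Bool → Prop) : Prop :=
  ∃ P, IsGadget I D S P ∧ ∀ x b, V x b → 1 - ε ≤ P x b

theorem Approximates.mono {D D' S S' : ℕ} {ε ε' : ℝ} {V V' : (I → Bool) → Bool → Prop}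
    (h : Approximates I D S ε V) (hD : D ≤ D') (hS : S ≤ S') (hε : ε ≤ ε')
    (hV : ∀ x b, V' x b → V x b) : Approximates I D' S' ε' V' := by
  obtain ⟨P, hP, hP'⟩ := h
  exact ⟨P, hP.mono hD hS, fun x b hx => by linarith [hP' x b (hV x b hx)]⟩

theorem one_sub_sum_le_prod {J : Type} (s : Finset J) (p ε : J → ℝ)
    (hp : ∀ j, p j ∈ Set.Icc 0 1) (hε : ∀ j, 1 - ε j ≤ p j) :
    1 - ∑ j ∈ s, ε j ≤ ∏ j ∈ s, p j := by
  classical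
  induction s using Finset.induction_on with
  | empty => simp
  | insert j s hj ih =>
    rw [Finset.sum_insert hj, Finset.prod_insert hj]
    have h1 : ∏ j ∈ s, p j ≤ 1 := Finset.prod_le_one (fun j _ => (hp j).1) fun j _ => (hp j).2
    nlinarith [mul_nonneg (sub_nonneg.2 h1) (sub_nonneg.2 (hp j).2), hε j]

/-- The probability that the inner gadgets produce the intended `z` and the outer one then answers
`b` is a lower bound; by independence it is a product, and the failure probabilities add. -/
theorem Approximates.comp {J : Type} [Fintype J] [DecidableEq J] {I : J → Type}
    [∀ j, Fintype (I j)] [∀ j, DecidableEq (I j)] {D D' S' : ℕ} {S : J → ℕ} {ε : J → ℝ} {ε' : ℝ}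
    {V : ∀ j, (I j → Bool) → Bool → Prop} {V' : (J → Bool) → Bool → Prop}
    (h : ∀ j, Approximates (I j) D (S j) (ε j) (V j)) (h' : Approximates J D' S' ε' V') :
    Approximates (Σ j, I j) (D + D') (∑ j, S j + S') (∑ j, ε j + ε')
      (fun x b => ∃ z, (∀ j, V j (fun i => x ⟨j, i⟩) (z j)) ∧ V' z b) := by
  choose P hP hV using h
  obtain ⟨P', hP', hV'⟩ := h'
  refine ⟨_, IsGadget.comp hP hP', ?_⟩
  rintro x b ⟨z, hz, hb⟩
  have h1 := one_sub_sum_le_prod univ (fun j => P j (fun i => x ⟨j, i⟩) (z j)) ε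
    (fun j => ⟨(hP j).nonneg _ _, (hP j).le_one _ _⟩) fun j => hV j _ _ (hz j)
  have h2 : ∏ j, P j (fun i => x ⟨j, i⟩) (z j) ≤ 1 :=
    Finset.prod_le_one (fun j _ => (hP j).nonneg _ _) fun j _ => (hP j).le_one _ _
  have h3 := hV' z b hb
  have h4 := hP'.le_one z b
  have h5 : (∏ j, P j (fun i => x ⟨j, i⟩) (z j)) * P' z b ≤
      ∑ z, (∏ j, P j (fun i => x ⟨j, i⟩) (z j)) * P' z b :=
    Finset.single_le_sum (f := fun z => (∏ j, P j (fun i => x ⟨j, i⟩) (z j)) * P' z b)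
      (fun z _ => mul_nonneg (Finset.prod_nonneg fun j _ => (hP j).nonneg _ _)
        (hP'.nonneg _ _)) (mem_univ z)
  nlinarith [mul_nonneg (sub_nonneg.2 h2) (sub_nonneg.2 h4)]

theorem approximates_or (J : Type) [Fintype J] [DecidableEq J] :
    Approximates J 3 (3 * Fintype.card J + 3) 0 (fun z b => b = decide (∃ j, z j = true)) :=
  ⟨_, isGadget_or J, by rintro z b rfl; simp [pointProb]⟩

end Approximation

/-! ### Amplification, exact weights and symmetric gates. -/

section ExactWeight

/-- With this `r`, Bernoulli gives `r ^ N ≥ 1/2`, so distinct powers with exponents at most `N`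
differ by at least `(1 - r) / 2 = 1 / (4 (N + 1))`. The denominator is at most 1. -/
theorem weightTest_gap (N k w : ℕ) (hk : k ≤ N) (hw : w ≤ N) (hkw : k ≠ w) (r : ℝ)
    (hr : r = 1 - 1 / (2 * (N + 1))) :
    1 / (16 * ((N : ℝ) + 1) ^ 2) ≤
      (r ^ k - r ^ w) ^ 2 / ((r ^ k) ^ 2 + (1 - r ^ k) ^ 2) := by
  have hN : (0 : ℝ) < 2 * (N + 1) := by positivity
  have hδ : 1 / (2 * ((N : ℝ) + 1)) ≤ 1 / 2 :=
    one_div_le_one_div_of_le (by norm_num) (by linarith [(Nat.cast_nonneg N : (0 : ℝ) ≤ N)])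
  have hδ0 : 0 < 1 / (2 * ((N : ℝ) + 1)) := by positivity
  have hr0 : 0 ≤ r := by linarith
  have hr1 : r ≤ 1 := by linarith
  have hhalf : 1 / 2 ≤ r ^ N := by
    have := one_add_mul_le_pow (a := -(1 / (2 * ((N : ℝ) + 1)))) (by linarith) N
    rw [← sub_eq_add_neg, ← hr] at this
    refine le_trans ?_ this
    have h2 : (N : ℝ) * (1 / (2 * (N + 1))) ≤ 1 / 2 := by
      rw [mul_one_div, div_le_iff₀ hN]
      linarith
    linarith
  have hgap : ∀ a b : ℕ, a < b → a ≤ N → 1 / (4 * ((N : ℝ) + 1)) ≤ r ^ a - r ^ b := by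
    intro a b hab ha
    have h1 : r ^ b ≤ r ^ (a + 1) := pow_le_pow_of_le_one hr0 hr1 hab
    have h2 : r ^ N ≤ r ^ a := pow_le_pow_of_le_one hr0 hr1 ha
    have h3 : 1 / (4 * ((N : ℝ) + 1)) = 1 / 2 * (1 / (2 * (N + 1))) := by
      rw [div_mul_div_comm]; ring_nf
    have h4 : 1 / (2 * ((N : ℝ) + 1)) = 1 - r := by linarith
    rw [h3, h4]
    rw [pow_succ] at h1
    nlinarith
  have hsq : 1 / (16 * ((N : ℝ) + 1) ^ 2) ≤ (r ^ k - r ^ w) ^ 2 := by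
    have h1 : 1 / (16 * ((N : ℝ) + 1) ^ 2) = (1 / (4 * ((N : ℝ) + 1))) ^ 2 := by
      rw [div_pow, mul_pow]; norm_num
    have h0 : 0 ≤ 1 / (4 * ((N : ℝ) + 1)) := by positivity
    rw [h1]
    rcases lt_or_gt_of_ne hkw with h | h
    · exact pow_le_pow_left₀ h0 (hgap k w h hk) 2
    · rw [← neg_sub, neg_sq]
      exact pow_le_pow_left₀ h0 (hgap w k h hw) 2
  have ha0 : 0 ≤ r ^ k := by positivity
  have ha1 : r ^ k ≤ 1 := pow_le_one₀ hr0 hr1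
  refine hsq.trans (le_div_self (sq_nonneg _) ?_ ?_)
  · nlinarith [sq_nonneg (2 * r ^ k - 1)]
  · nlinarith

theorem one_sub_pow_le_two_inv_pow (δ : ℝ) (m q : ℕ) (hδ : δ ≤ 1) (h : (q : ℝ) ≤ m * δ) :
    (1 - δ) ^ m ≤ (2 : ℝ)⁻¹ ^ q := by
  calc (1 - δ) ^ m ≤ Real.exp (-δ) ^ m :=
        pow_le_pow_left₀ (by linarith) (Real.one_sub_le_exp_neg δ) m
    _ = Real.exp (-(m * δ)) := by rw [← Real.exp_nat_mul]; ring_nf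
    _ ≤ Real.exp (-(q : ℝ)) := Real.exp_le_exp.2 (by linarith)
    _ = Real.exp (-1) ^ q := by rw [← Real.exp_nat_mul]; ring_nf
    _ ≤ (2 : ℝ)⁻¹ ^ q := by
        refine pow_le_pow_left₀ (Real.exp_pos _).le ?_ q
        rw [Real.exp_neg]
        exact inv_anti₀ (by norm_num) (by linarith [Real.add_one_le_exp (1 : ℝ)])

variable {ι : Type} [Fintype ι] [DecidableEq ι]

omit [DecidableEq ι] in
theorem hammingWeight_le_card (x : ι → Bool) : hammingWeight x ≤ Fintype.card ι :=
  Finset.card_filter_le _ _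

/-- Deciding whether the weight of the input is `k`, given many copies of the input. -/
theorem approximates_exactWeight (N k q : ℕ) (hι : Fintype.card ι ≤ N) (hk : k ≤ N) (m : ℕ)
    (hm : m = 16 * (N + 1) ^ 2 * q) :
    Approximates (Σ _ : Fin m, ι) 13 (m * (19 * N + 14) + 3) ((2 : ℝ)⁻¹ ^ q)
      (fun x b => ∃ y : ι → Bool, (x = fun i => y i.2) ∧ b = decide (hammingWeight y = k)) := by
  have hN : (0 : ℝ) < 2 * (N + 1) := by positivity
  have hδ0 : 0 < 1 / (2 * ((N : ℝ) + 1)) := by positivity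
  have hδ : 1 / (2 * ((N : ℝ) + 1)) ≤ 1 / 2 :=
    one_div_le_one_div_of_le (by norm_num) (by linarith [(Nat.cast_nonneg N : (0 : ℝ) ≤ N)])
  obtain ⟨P, hP, hP'⟩ := exists_isGadget_weightTest ι (1 - 1 / (2 * ((N : ℝ) + 1)))
    (by linarith) (by linarith) k
  obtain ⟨PA, hA, hA1, hA0⟩ : ∃ PA, IsGadget (Fin m) 3 (3 * Fintype.card (Fin m) + 3) PA ∧
      PA (fun _ => true) true = 1 ∧ ∀ z ≠ fun _ => true, PA z true = 0 := by
    refine ⟨_, isGadget_and (Fin m), by simp [pointProb], fun z hz => ?_⟩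
    have : ¬ ∀ j, z j = true := fun h => hz (funext h)
    simp [pointProb, this]
  have hg := IsGadget.comp (J := Fin m) (fun _ => hP) hA
  refine ⟨_, hg.mono le_rfl ?_, ?_⟩
  · simp only [Finset.sum_const, Finset.card_univ, Fintype.card_fin, smul_eq_mul]
    nlinarith [Nat.mul_le_mul_left m hι]
  rintro x b ⟨y, rfl, rfl⟩
  -- The AND says 1 only if all `m` independent runs do. The error is one-sided: at weight `k` every
  -- run says 1 with certainty.
  have htrue : ∑ z : Fin m → Bool, (∏ j, P (fun i => y i) (z j)) * PA z true =
      P y true ^ m := by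
    rw [Fintype.sum_eq_single fun _ => true]
    · simp [hA1]
    · intro z hz
      rw [hA0 z hz, mul_zero]
  have hsum := hg.add_eq_one fun i => y i.2
  have hadd := hP.add_eq_one y
  by_cases hw : hammingWeight y = k
  · rw [decide_eq_true hw]
    have h0 := hP' y
    rw [hw, sub_self, zero_pow two_ne_zero, zero_div] at h0
    refine le_trans ?_ htrue.ge
    rw [show P y true = 1 by linarith, one_pow]
    have : (0 : ℝ) ≤ 2⁻¹ ^ q := by positivity
    linarith
  · rw [decide_eq_false hw]
    have h1 := weightTest_gap N k (hammingWeight y) hk ((hammingWeight_le_card y).trans hι)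
      (Ne.symm hw) _ rfl
    rw [← hP' y] at h1
    -- The choice of `m` makes `m` times the gap equal to `q`.
    have h2 := one_sub_pow_le_two_inv_pow (1 / (16 * ((N : ℝ) + 1) ^ 2)) m q ?_ ?_
    · have h3 : P y true ^ m ≤ (1 - 1 / (16 * ((N : ℝ) + 1) ^ 2)) ^ m :=
        pow_le_pow_left₀ (hP.nonneg _ _) (by linarith) m
      linarith
    · exact h1.trans (hP.le_one _ _)
    · rw [hm]
      push_cast
      have : ((N : ℝ) + 1) ^ 2 ≠ 0 := by positivity
      field_simp
      rfl

/-- A gadget for a symmetric gate, given many copies of its input. -/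
theorem exists_approximates_symmetricGate (f : (ι → Bool) → Bool) (hf : SymmetricGate ι f)
    (N q m : ℕ) (hι : Fintype.card ι ≤ N) (hm : m = 16 * (N + 1) ^ 2 * q) :
    ∃ (L : Type) (_ : Fintype L) (_ : DecidableEq L) (π : L → ι),
      Fintype.card L ≤ (N + 1) * (m * N) ∧
      Approximates L 16 ((N + 1) * (m * (19 * N + 14) + 6) + 3) ((N + 1) * (2 : ℝ)⁻¹ ^ q)
        (fun x b => ∃ y : ι → Bool, x = y ∘ π ∧ b = f y) := by
  classical
  -- `K` is the set of accepted weights; there are at most `N + 1` of them, whence the factor in the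
  -- error bound.
  let K : Type := {k : Fin (N + 1) // ∃ y : ι → Bool, hammingWeight y = k ∧ f y = true}
  have hK : Fintype.card K ≤ N + 1 := (Fintype.card_subtype_le _).trans (by simp)
  refine ⟨Σ _ : K, Σ _ : Fin m, ι, inferInstance, inferInstance, fun p => p.2.2, ?_, ?_⟩
  · simp only [Fintype.card_sigma, Finset.sum_const, Finset.card_univ, Fintype.card_fin,
      smul_eq_mul]
    exact Nat.mul_le_mul hK (Nat.mul_le_mul_left m hι)
  · refine (Approximates.comp (J := K) (fun k =>
      approximates_exactWeight (ι := ι) N k q hι (Nat.lt_succ_iff.1 k.1.2) m hm)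
      (approximates_or K)).mono le_rfl ?_ ?_ ?_
    · simp only [Finset.sum_const, Finset.card_univ, smul_eq_mul]
      nlinarith [Nat.mul_le_mul_right (m * (19 * N + 14) + 6) hK]
    · simp only [Finset.sum_const, Finset.card_univ, nsmul_eq_mul, add_zero]
      have : (Fintype.card K : ℝ) ≤ N + 1 := by exact_mod_cast hK
      gcongr
    · rintro x b ⟨y, rfl, rfl⟩
      refine ⟨fun k => decide (hammingWeight y = k.1), fun k => ⟨y, rfl, rfl⟩, ?_⟩
      rw [Bool.eq_iff_iff, decide_eq_true_iff]
      constructor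
      · intro h
        exact ⟨⟨⟨hammingWeight y, Nat.lt_succ_iff.2 ((hammingWeight_le_card y).trans hι)⟩,
          y, rfl, h⟩, by simp⟩
      · rintro ⟨⟨k, y', hy', hfy⟩, hk⟩
        rw [decide_eq_true_iff] at hk
        rw [← hfy]
        exact hf _ _ (hk.trans hy'.symm)

end ExactWeight

/-! ### Simulating circuits of symmetric gates. -/

section Circuits

/-- There is a gadget which, reading copies of the input bits, yields the value of `g` up to an
error probability `ε`. -/
def CopyApproximates (n D S : ℕ) (ε : ℝ) (g : (Fin n → Bool) → Bool) : Prop :=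
  ∃ (I : Type) (_ : Fintype I) (_ : DecidableEq I) (φ : I → Fin n),
    Approximates I D S ε (fun x b => ∃ y : Fin n → Bool, x = y ∘ φ ∧ b = g y)

theorem CopyApproximates.mono {n D D' S S' : ℕ} {ε ε' : ℝ} {g : (Fin n → Bool) → Bool}
    (h : CopyApproximates n D S ε g) (hD : D ≤ D') (hS : S ≤ S') (hε : ε ≤ ε') :
    CopyApproximates n D' S' ε' g := by
  obtain ⟨I, _, _, φ, h⟩ := h
  exact ⟨I, _, _, φ, h.mono hD hS hε fun _ _ h => h⟩

/-- The output of a gadget must be a work qubit, so the bit is passed through a one-bit OR. -/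
theorem copyApproximates_input (n : ℕ) (k : Fin n) : CopyApproximates n 3 6 0 (fun x => x k) := by
  refine ⟨Unit, inferInstance, inferInstance, fun _ => k,
    (approximates_or Unit).mono le_rfl (by simp) le_rfl ?_⟩
  rintro x b ⟨y, rfl, rfl⟩
  simp

/-- Every wire `l` gets its own evaluation of `g (π l)` on its own copies, even when several wires
carry the same bit. This replaces fan-out and causes the factor `Fintype.card L`. -/
theorem CopyApproximates.gate {n D S : ℕ} {ε : ℝ} {ι L : Type} [Fintype L] [DecidableEq L]
    {π : L → ι} {f : (ι → Bool) → Bool} {D' S' : ℕ} {ε' : ℝ}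
    (h' : Approximates L D' S' ε' (fun x b => ∃ y : ι → Bool, x = y ∘ π ∧ b = f y))
    {g : ι → (Fin n → Bool) → Bool} (h : ∀ i, CopyApproximates n D S ε (g i)) :
    CopyApproximates n (D + D') (Fintype.card L * S + S') (Fintype.card L * ε + ε')
      (fun x => f fun i => g i x) := by
  choose I i1 i2 φ hI using h
  refine ⟨Σ l, I (π l), inferInstance, inferInstance, fun p => φ _ p.2,
    (Approximates.comp (fun l => hI (π l)) h').mono le_rfl ?_ ?_ ?_⟩
  · simp
  · simp
  · rintro x b ⟨y, rfl, rfl⟩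
    exact ⟨fun l => g (π l) y, fun l => ⟨y, rfl, rfl⟩, fun i => g i y, rfl, rfl⟩

theorem natCast_mul_two_inv_pow_le (a b q : ℕ) (h : a ≤ 2 ^ b) :
    (a : ℝ) * 2⁻¹ ^ (q + b) ≤ 2⁻¹ ^ q := by
  have h1 : (a : ℝ) ≤ 2 ^ b := by exact_mod_cast h
  have h2 : (2 : ℝ) ^ b * 2⁻¹ ^ b = 1 := by rw [← mul_pow]; norm_num
  have h3 : (0 : ℝ) < 2⁻¹ ^ q := by positivity
  have h4 : (0 : ℝ) < 2⁻¹ ^ b := by positivity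
  rw [pow_add]
  calc (a : ℝ) * (2⁻¹ ^ q * 2⁻¹ ^ b) ≤ 2 ^ b * (2⁻¹ ^ q * 2⁻¹ ^ b) := by gcongr
    _ = 2⁻¹ ^ q * (2 ^ b * 2⁻¹ ^ b) := by ring
    _ = 2⁻¹ ^ q := by rw [h2, mul_one]

/-- Nodes of bounded depth of circuits with symmetric gates are approximated by QAC circuits of
bounded depth that read copies of the input. -/
theorem exists_copyApproximates_nodeVal (d : ℕ) : ∃ D : ℕ, ∀ s q : ℕ[X], ∃ p : ℕ[X],
    ∀ (n : ℕ) (C : BoolCircuit n), C.UsesGates SymmetricGate → C.size ≤ s.eval n →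
      ∀ v, C.nodeDepth v < d →
        CopyApproximates n D (p.eval n) (2⁻¹ ^ q.eval n) (fun x => C.nodeVal x v) := by
  induction d with
  | zero => exact ⟨0, fun s q => ⟨0, fun n C _ _ v hv => by simp at hv⟩⟩
  | succ d ih =>
    obtain ⟨D, ih⟩ := ih
    -- A symmetric gate costs 16 layers: 7 for the interference, then 3 each for OR, AND and OR. The
    -- count does not depend on `s` and `q`.
    refine ⟨D + 16, fun s q => ?_⟩
    -- `N` bounds the fan-in (inputs plus gates), and `T` the number of wires after copying. The
    -- extra exponents `N` and `T` absorb the factors `N + 1` and `T` from the union bounds; the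
    -- extra 1 halves the error, one half for the gate and one for its children.
    let N : ℕ[X] := X + s
    let m : ℕ[X] := 16 * (N + 1) ^ 2 * (q + 1 + N)
    let T : ℕ[X] := (N + 1) * (m * N)
    obtain ⟨p, ih⟩ := ih s (q + 1 + T)
    refine ⟨T * p + ((N + 1) * (m * (19 * N + 14) + 6) + 3), fun n C hC hs v hv => ?_⟩
    cases v with
    | inl k =>
      refine (copyApproximates_input n k).mono (by omega) ?_ (by positivity)
      simp only [eval_add, eval_mul, eval_one, eval_ofNat]
      nlinarith [Nat.zero_le ((T.eval n) * (p.eval n)),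
        Nat.zero_le (m.eval n * (19 * N.eval n + 14)), Nat.zero_le (N.eval n),
        Nat.zero_le (N.eval n * (m.eval n * (19 * N.eval n + 14)))]
    | inr i =>
      have hι : Fintype.card (C.ins i) ≤ N.eval n := by
        rw [Fintype.card_coe]
        refine (Finset.card_le_univ _).trans ?_
        simp only [Fintype.card_sum, Fintype.card_fin, N, eval_add, eval_X]
        simpa using hs
      obtain ⟨L, _, _, π, hL, hgate⟩ := exists_approximates_symmetricGate (C.fn i) (hC i)
        (N.eval n) ((q + 1 + N).eval n) (m.eval n) hι (by simp [m])
      have hchild : ∀ w : C.ins i, CopyApproximates n D (p.eval n) (2⁻¹ ^ (q + 1 + T).eval n)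
          (fun x => C.nodeVal x w) := by
        intro w
        refine ih n C hC hs w ?_
        have h1 : C.nodeDepth w + 1 ≤ C.gateDepth i := by
          rw [BoolCircuit.gateDepth_eq]
          exact Finset.le_sup (f := fun w => C.nodeDepth w + 1) w.2
        have h2 : C.gateDepth i < d + 1 := hv
        omega
      have h := CopyApproximates.gate hgate hchild
      have hval : (fun x => C.nodeVal x (Sum.inr i)) =
          fun x => C.fn i fun w => C.nodeVal x w := funext fun x => C.gateVal_eq x i
      rw [hval]
      have hT : Fintype.card L ≤ T.eval n := by simpa [T] using hL
      refine h.mono le_rfl ?_ ?_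
      · simp only [eval_add, eval_mul, eval_one, eval_ofNat]
        gcongr
      · simp only [eval_add, eval_one]
        have e1 := natCast_mul_two_inv_pow_le (Fintype.card L) (T.eval n) (q.eval n + 1)
          (hT.trans Nat.lt_two_pow_self.le)
        have e2 := natCast_mul_two_inv_pow_le (N.eval n + 1) (N.eval n) (q.eval n + 1)
          Nat.lt_two_pow_self
        push_cast at e2
        have e3 : (2 : ℝ)⁻¹ ^ (q.eval n + 1) + 2⁻¹ ^ (q.eval n + 1) = 2⁻¹ ^ q.eval n := by
          rw [pow_succ]; ring
        linarith

end Circuits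

/-! ### From gadgets to circuits on the standard register. -/

section Registers

variable {I : Type} [Fintype I] [DecidableEq I] {D S : ℕ} {P : (I → Bool) → Bool → ℝ}

theorem IsGadget.card_le (h : IsGadget I D S P) : Fintype.card I ≤ S := by
  obtain ⟨R, _, _, o, A, G, -, hG, -⟩ := h
  rw [Fintype.card_sum] at hG
  omega

theorem IsGadget.exists_register (h : IsGadget I D S P) :
    ∃ (a : ℕ) (C : QACCircuit (Register I a)), C.depth = D ∧ C.size ≤ S ∧
      ∀ x b, C.outputProb x b = P x b := by
  obtain ⟨R, _, _, o, A, G, hA, hG, -, hP⟩ := h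
  obtain ⟨a, ha⟩ : ∃ a, Fintype.card R = a + 1 :=
    Nat.exists_eq_succ_of_ne_zero (Fintype.card_pos_iff.2 ⟨o⟩).ne'
  let e₀ : R ≃ Fin a ⊕ Unit := Fintype.equivOfCardEq (by simp [ha])
  -- The swap moves the output qubit of the gadget to the prescribed last position.
  let e : R ≃ Fin a ⊕ Unit := e₀.trans (Equiv.swap (e₀ o) (Sum.inr ()))
  have he : e o = Sum.inr () := by simp [e]
  let E : I ⊕ R ≃ Register I a := Equiv.sumCongr (Equiv.refl I) e
  obtain ⟨C, hD, hC, hCA⟩ := hA.lift E.toEmbedding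
  refine ⟨a, C, hD, ?_, fun x b => ?_⟩
  · have : Fintype.card (Register I a) = Fintype.card (I ⊕ R) := Fintype.card_congr E.symm
    rw [QACCircuit.size, this]
    omega
  · rw [hP, QACCircuit.outputProb, outcomeProb, Finset.sum_filter, Finset.sum_filter]
    refine Fintype.sum_equiv (E.symm.arrowCongr (Equiv.refl Bool)) _ _ fun y => ?_
    have h1 : (E.symm.arrowCongr (Equiv.refl Bool)) y = y ∘ E := rfl
    have h2 : (Register.init x : Register I a → Bool) ∘ E = Sum.elim x fun _ => false := by
      funext q
      rcases q with q | q <;> rfl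
    have h3 : E (Sum.inr o) = Sum.inr (Sum.inr ()) := congrArg Sum.inr he
    rw [h1, hCA, liftMatrix_equiv_apply, h2, Function.comp_apply, h3]

end Registers

/-! ### Full copies of the input. -/

section Copies

theorem CopyApproximates.exists_isGadget {n D S : ℕ} {ε : ℝ} {g : (Fin n → Bool) → Bool}
    (h : CopyApproximates n D S ε g) (m : ℕ) (hm : S ≤ m) :
    ∃ P, IsGadget (Fin m × Fin n) D (m * n + S) P ∧ ∀ x, 1 - ε ≤ P (fun i => x i.2) (g x) := by
  obtain ⟨I, _, _, φ, P, hP, hg⟩ := h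
  have hI : Fintype.card I ≤ Fintype.card (Fin m) := by
    simpa using hP.card_le.trans hm
  obtain ⟨e⟩ := Function.Embedding.nonempty_of_card_le hI
  -- Each wire is given a private copy, indexed by `e i`, from which it reads bit `φ i`. There are
  -- enough copies because a gadget has at most `S` input wires.
  let ψ : I ↪ Fin m × Fin n := ⟨fun i => (e i, φ i), fun i j h => e.injective (congrArg Prod.fst h)⟩
  refine ⟨_, (hP.mapInputs ψ).mono le_rfl (by simp), fun x => ?_⟩
  exact hg _ _ ⟨x, rfl, rfl⟩

theorem exists_qacCircuit_of_symmetricGates (d : ℕ) : ∃ D : ℕ, ∀ s q : ℕ[X], ∃ p : ℕ[X],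
    ∀ (n : ℕ) (f : (Fin n → Bool) → Bool),
      (∃ C : BoolCircuit n, C.UsesGates SymmetricGate ∧ C.depth ≤ d ∧
        C.size ≤ s.eval n ∧ C.Computes f) →
      CopyApproximates n D (p.eval n) (2⁻¹ ^ q.eval n) f := by
  obtain ⟨D, hD⟩ := exists_copyApproximates_nodeVal (d + 1)
  refine ⟨D, fun s q => ?_⟩
  obtain ⟨p, hp⟩ := hD s q
  refine ⟨p, fun n f => ?_⟩
  rintro ⟨C, hC, hd, hs, hf⟩
  have := hp n C hC hs C.out (Nat.lt_succ_iff.2 hd)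
  rwa [show (fun x => C.nodeVal x C.out) = f from funext hf] at this

end Copies

/-! ### Checking that alleged copies agree. -/

section Consistency

variable {J : Type} [Fintype J] [DecidableEq J]

/-- Add the input bits, permuted by `τ`, to the work qubits. -/
def addInputs (τ : J ≃ J) (z : (J ⊕ Unit) ⊕ (J ⊕ Unit) → Bool) : (J ⊕ Unit) ⊕ (J ⊕ Unit) → Bool
  | Sum.inr (Sum.inl j) => xor (z (Sum.inr (Sum.inl j))) (z (Sum.inl (Sum.inl (τ j))))
  | q => z q

theorem hasCircuit_addInputs (τ : J ≃ J) :
    HasCircuit 1 (Fintype.card J) (permMatrix (addInputs τ)) := by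
  refine HasCircuit.toffolis (fun j => {Sum.inl (Sum.inl (τ j))})
    (fun j => Sum.inr (Sum.inl j)) (by simp) (fun i j hij => ?_) _ (fun x i => ?_)
    fun x q hq => ?_
  · simp [hij.symm]
  · simp [addInputs]
  · rcases q with (q | q) | (q | q) <;> simp_all [addInputs]

/-- A gadget which passes on a bit if the other input bits are invariant under a permutation, and
which yields `0` otherwise. -/
theorem isGadget_invariance (σ : J ≃ J) :
    IsGadget (J ⊕ Unit) 4 (5 * Fintype.card J + 3) (fun z b =>
      pointProb (decide (z (Sum.inr ()) = true ∧ ∀ j, z (Sum.inl (σ j)) = z (Sum.inl j))) b) := by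
  let W : J ↪ (J ⊕ Unit) ⊕ (J ⊕ Unit) := Function.Embedding.inl.trans Function.Embedding.inr
  -- The work qubit at `j` collects `x j` and `x (σ j)` in two separate layers, and is 0 iff they
  -- agree. As `σ` is bijective, each layer reads every input at most once, so its gates are
  -- disjoint.
  have h := ((HasCircuit.toffoli (insert (Sum.inl (Sum.inr ())) (univ.map W))
      (Sum.inr (Sum.inr ())) (by simp [W])).mul (HasCircuit.nots (univ.map W))).mul
    ((hasCircuit_addInputs σ).mul (hasCircuit_addInputs (Equiv.refl J)))
  simp only [permMatrix_mul] at h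
  refine ((IsGadget.of_permMatrix h ?_ (Sum.inr ())).mono (by norm_num) ?_).congr fun x b => ?_
  · rintro x (i | i) <;> simp [toffoliMap, addInputs, W]
  · simp only [Fintype.card_sum, Fintype.card_unit, Finset.card_map, Finset.card_univ]
    omega
  · congr 1
    have hiff : (∀ j, x (Sum.inl j) = x (Sum.inl (σ j))) ↔
        ∀ j, x (Sum.inl (σ j)) = x (Sum.inl j) := forall_congr' fun j => eq_comm
    simp [toffoliMap, addInputs, W, hiff]

/-- The gadget leaves its inputs intact, so the invariance check can read them afterwards together
with the output bit; no further copies are needed. -/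
theorem IsGadget.guard {D S : ℕ} {P : (J → Bool) → Bool → ℝ} (h : IsGadget J D S P) (σ : J ≃ J) :
    ∃ P', IsGadget J (D + 4) (S + (5 * Fintype.card J + 3)) P' ∧
      (∀ x b, (∀ j, x (σ j) = x j) → P' x b = P x b) ∧
      ∀ x, (¬ ∀ j, x (σ j) = x j) → P' x false = 1 := by
  obtain ⟨R, _, _, o, A, G, hA, hG, hc, hP⟩ := h
  let e : J ⊕ Unit ↪ J ⊕ R :=
    ⟨Sum.map id fun _ => o, Function.Injective.sumMap Function.injective_id fun _ _ _ => rfl⟩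
  refine ⟨_, (IsGadget.seq hA hc (isGadget_invariance σ) e).mono le_rfl
    (Nat.add_le_add_right hG _), fun x b hx => ?_, fun x hx => ?_⟩
  · rw [hc.sum_eq, hP, hc.outcomeProb_eq]
    refine Finset.sum_congr rfl fun r _ => ?_
    congr 1
    simp [e, pointProb, hx]
  · rw [← hA.sum_norm_sq (Sum.elim x fun _ => false)]
    have h1 := hc.sum_eq x (fun _ => false) fun _ => 1
    simp only [mul_one] at h1
    rw [hc.sum_eq, h1]
    refine Finset.sum_congr rfl fun r _ => ?_
    simp [e, pointProb, hx]

/-- Invariance under the cyclic shift equates each copy with the next, hence all with copy 0. -/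
theorem eq_comp_snd_of_rotate_invariant {m n : ℕ} (x : Fin (m + 1) × Fin n → Bool)
    (hx : ∀ j, x ((finRotate (m + 1)).prodCongr (Equiv.refl _) j) = x j) :
    x = fun i => x (0, i.2) := by
  funext ⟨i, k⟩
  induction i using Fin.induction with
  | zero => rfl
  | succ i ih =>
    rw [← ih, ← hx (i.castSucc, k)]
    simp

end Consistency

/-! ### The inclusion of complexity classes. -/

section Classes

theorem NotGate.symmetricGate {ι : Type} [Fintype ι] {f : (ι → Bool) → Bool} (h : NotGate ι f) :
    SymmetricGate ι f := by
  obtain ⟨i, hi, hf⟩ := h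
  intro x y hxy
  have hcard : ∀ z : ι → Bool, hammingWeight z = if z i = true then 1 else 0 := by
    intro z
    have hu : (univ : Finset ι) = {i} := by
      ext j
      simp [hi j]
    rw [hammingWeight, hu, Finset.filter_singleton]
    split_ifs <;> simp
  rw [hcard, hcard] at hxy
  rw [hf, hf]
  cases hx : x i <;> cases hy : y i <;> simp_all

theorem ThresholdGate.symmetricGate {ι : Type} [Fintype ι] {f : (ι → Bool) → Bool}
    (h : ThresholdGate ι f) : SymmetricGate ι f := by
  rcases h with h | ⟨k, hk⟩
  · exact h.symmetricGate
  · intro x y hxy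
    rw [hk, hk, hxy]

theorem natPolynomial_eval_mono (p : ℕ[X]) {a b : ℕ} (h : a ≤ b) : p.eval a ≤ p.eval b := by
  rw [Polynomial.eval_eq_sum, Polynomial.eval_eq_sum]
  exact Finset.sum_le_sum fun i _ => Nat.mul_le_mul_left _ (Nat.pow_le_pow_left h i)

/-- The family of functions that make `m n + 1` copies of their input. -/
def copies (m : ℕ → ℕ) (n : ℕ) (x : Fin n → Bool) : Fin ((m n + 1) * n) → Bool :=
  fun j => x (finProdFinEquiv.symm j).2

theorem copies_injective (m : ℕ → ℕ) (n : ℕ) : Function.Injective (copies m n) := by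
  intro x y h
  funext k
  have := congrFun h (finProdFinEquiv (0, k))
  simpa [copies] using this

theorem nc0Computable_copies (p : ℕ[X]) :
    NC0Computable (fun n => (p.eval n + 1) * n) (copies fun n => p.eval n) := by
  refine ⟨⟨(p + 1) * X, fun n => by simp⟩, 0, 0, fun n j => ?_⟩
  -- Each output bit is an input bit, so a circuit without gates suffices.
  exact ⟨⟨0, fun i => i.elim0, fun i => i.elim0, fun i => i.elim0,
    Sum.inl (finProdFinEquiv.symm j).2⟩, fun i => i.elim0, fun i => i.elim0, le_rfl, fun x => rfl⟩

/-- The language of the copies of the elements of `f`. -/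
noncomputable def copiesLanguage (m : ℕ → ℕ) (f : BoolFamily) : BoolFamily := fun N y =>
  open Classical in decide (∃ (n : ℕ) (x : Fin n → Bool) (e : (m n + 1) * n = N),
    f n x = true ∧ ∀ j, y (Fin.cast e j) = copies m n x j)

/-- The length `(m n + 1) * n` is strictly increasing in `n`, so it determines `n`. The `+ 1`
secures this, as well as the presence of a copy from which `x` can be recovered. -/
theorem copiesLanguage_eq_true_iff {m : ℕ → ℕ} (hm : Monotone m) (f : BoolFamily) (n : ℕ)
    (y : Fin ((m n + 1) * n) → Bool) :
    copiesLanguage m f _ y = true ↔ ∃ x, f n x = true ∧ y = copies m n x := by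
  have hl : StrictMono fun n => (m n + 1) * n := by
    intro a b hab
    have h1 : m a ≤ m b := hm hab.le
    exact lt_of_lt_of_le (Nat.mul_lt_mul_of_pos_left hab (Nat.succ_pos _))
      (Nat.mul_le_mul_right b (Nat.succ_le_succ h1))
  classical
  rw [copiesLanguage, decide_eq_true_iff]
  constructor
  · rintro ⟨n', x, e, hx, hy⟩
    obtain rfl := hl.injective e
    exact ⟨x, hx, funext hy⟩
  · rintro ⟨x, hx, rfl⟩
    exact ⟨n, x, rfl, hx, fun j => rfl⟩

theorem copiesLanguage_copies {m : ℕ → ℕ} (hm : Monotone m) (f : BoolFamily) (n : ℕ)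
    (x : Fin n → Bool) : copiesLanguage m f _ (copies m n x) = f n x := by
  rw [Bool.eq_iff_iff, copiesLanguage_eq_true_iff hm]
  constructor
  · rintro ⟨x', hx', h⟩
    rwa [copies_injective m n h]
  · exact fun h => ⟨x, h, rfl⟩

theorem copiesLanguage_mem_BQAC0 (p : ℕ[X]) (D : ℕ) (f : BoolFamily)
    (h : ∀ n, CopyApproximates n D (p.eval n) (1 / 3) (f n)) :
    copiesLanguage (fun n => p.eval n) f ∈ BQAC0 := by
  have hmono : Monotone fun n : ℕ => p.eval n := fun a b hab => natPolynomial_eval_mono p hab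
  -- On `N` bits, relabelling and unused copies cost `N` each, the gadget `p.eval n ≤ p.eval N`, and
  -- the guard `5 N + 3`.
  refine ⟨D + 4, 7 * X + p + 3, fun N => ?_⟩
  by_cases hN : ∃ n, (p.eval n + 1) * n = N
  · obtain ⟨n, rfl⟩ := hN
    obtain ⟨P, hP, hPf⟩ := (h n).exists_isGadget (p.eval n + 1) (Nat.le_succ _)
    obtain ⟨P', hP', hcons, hincons⟩ :=
      hP.guard ((finRotate (p.eval n + 1)).prodCongr (Equiv.refl (Fin n)))
    obtain ⟨a, C, hCD, hCS, hC⟩ := (hP'.mapInputs finProdFinEquiv.toEmbedding).exists_register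
    refine ⟨a, C, hCD.le, hCS.trans ?_, fun x => ?_⟩
    · have hle : n ≤ (p.eval n + 1) * n := Nat.le_mul_of_pos_left n (Nat.succ_pos _)
      have := natPolynomial_eval_mono p hle
      simp only [Fintype.card_fin, Fintype.card_prod, eval_add, eval_mul, eval_ofNat, eval_X]
      omega
    · rw [hC]
      set x' : Fin (p.eval n + 1) × Fin n → Bool := x ∘ finProdFinEquiv.toEmbedding with hx'
      by_cases hx : ∀ j, x' ((finRotate (p.eval n + 1)).prodCongr (Equiv.refl (Fin n)) j) = x' j
      · have hxe := eq_comp_snd_of_rotate_invariant x' hx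
        have hxc : x = copies (fun n => p.eval n) n fun k => x' (0, k) := by
          funext j
          have := congrFun hxe (finProdFinEquiv.symm j)
          simp only [hx', Function.comp_apply, Equiv.coe_toEmbedding,
            Equiv.apply_symm_apply] at this
          exact this
        have hval : copiesLanguage (fun n => p.eval n) f _ x = f n fun k => x' (0, k) := by
          conv_lhs => rw [hxc]
          exact copiesLanguage_copies hmono f n _
        rw [hval, hcons _ _ hx]
        have := hPf fun k => x' (0, k)
        rwa [← hxe] at this
      · have hval : copiesLanguage (fun n => p.eval n) f _ x = false := by
          rw [Bool.eq_false_iff]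
          intro ht
          obtain ⟨y, -, rfl⟩ := (copiesLanguage_eq_true_iff hmono f n x).1 ht
          refine hx fun j => ?_
          simp [hx', copies]
        rw [hval, hincons _ hx]
        norm_num
  -- No word of this length belongs to the language, so the empty circuit, whose output stays 0, is
  -- correct.
  · obtain ⟨a, C, hCD, hCS, hC⟩ := (IsGadget.of_permMatrix (I := Fin N) (R := Unit) (F := id)
      (by rw [permMatrix_id]; exact HasCircuit.one 0) (fun _ _ => rfl) ()).exists_register
    refine ⟨a, C, by omega, hCS.trans ?_, fun x => ?_⟩
    · simp only [Fintype.card_sum, Fintype.card_fin, Fintype.card_unit, eval_add, eval_mul,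
        eval_ofNat, eval_X]
      omega
    · have hval : copiesLanguage (fun n => p.eval n) f _ x = false := by
        rw [copiesLanguage, decide_eq_false_iff_not]
        rintro ⟨n, -, e, -⟩
        exact hN ⟨n, e⟩
      rw [hC, hval]
      simp [pointProb]

end Classes

theorem theorem1p2 :
    (∀ d : ℕ, ∃ D : ℕ, ∀ s q : ℕ[X], ∃ p : ℕ[X],
      ∀ (n : ℕ) (f : (Fin n → Bool) → Bool),
        (∃ C : BoolCircuit n, C.UsesGates SymmetricGate ∧ C.depth ≤ d ∧
          C.size ≤ s.eval n ∧ C.Computes f) →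
        ∃ m ≤ p.eval n, ∃ (a : ℕ) (A : QACCircuit (Register (Fin m × Fin n) a)),
          A.depth ≤ D ∧ A.size ≤ p.eval n ∧
          ∀ x : Fin n → Bool,
            1 - (2 : ℝ)⁻¹ ^ (q.eval n) ≤ A.outputProb (fun i => x i.2) (f x)) ∧
    TC0 ⊆ compNC0 BQAC0 := by
  constructor
  · intro d
    obtain ⟨D, hD⟩ := exists_qacCircuit_of_symmetricGates d
    refine ⟨D, fun s q => ?_⟩
    obtain ⟨p, hp⟩ := hD s q
    refine ⟨p * X + p, fun n f hf => ?_⟩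
    obtain ⟨P, hP, hPf⟩ := (hp n f hf).exists_isGadget (p.eval n) le_rfl
    obtain ⟨a, C, hCD, hCS, hC⟩ := hP.exists_register
    refine ⟨p.eval n, by simp, a, C, hCD.le, by simpa using hCS, fun x => ?_⟩
    rw [hC]
    exact hPf x
  · rintro f ⟨d, s, hf⟩
    obtain ⟨D, hD⟩ := exists_qacCircuit_of_symmetricGates d
    -- The constant polynomial 2 gives error `1/4 ≤ 1/3`.
    obtain ⟨p, hp⟩ := hD s 2
    have hcopy : ∀ n, CopyApproximates n D (p.eval n) (1 / 3) (f n) := by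
      intro n
      obtain ⟨C, hC, hd, hs, hcomp⟩ := hf n
      refine (hp n (f n) ⟨C, fun i => (hC i).symmetricGate, hd, hs, hcomp⟩).mono le_rfl le_rfl ?_
      rw [eval_ofNat]
      norm_num
    exact ⟨_, _, nc0Computable_copies p, _, copiesLanguage_mem_BQAC0 p D f hcopy,
      fun n x => (copiesLanguage_copies
        (fun a b hab => natPolynomial_eval_mono p hab) f n x).symm⟩
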